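/- Let \(p,p_1,p_2,n_1,n_2\ge 0\) be integers, \(\sigma_1,\sigma_2\ge 0\), and let \(w_1,w_2\in\mathbb R^p\), \(q_1\in\mathbb R^{p_1}\), \(q_2\in\mathbb R^{p_2}\) be fixed true parameters of a source task (\(i=1\)) and a target task (\(i=2\)). For \(i=1,2\) the \(n_i\) training samples of task \(i\) are \((X_i,Z_i,y_i)\) with random matrices \(X_i\in\mathbb R^{p\times n_i}\) (common features), \(Z_i\in\mathbb R^{p_i\times n_i}\) (task-specific features) and \[ y_i = X_i^{T}w_i+Z_i^{T}q_i+\epsilon_i ,\] where all entries of \(X_1,Z_1,\epsilon_1,X_2,Z_2,\epsilon_2\) are independent, the entries of \(X_i,Z_i\) are \(\mathcal N(0,1)\) and those of \(\epsilon_i\in\mathbb R^{n_i}\) are \(\mathcal N(0,\sigma_i^2)\). The training loss of task \(i\) is \(\mathcal L_i(w,q)=\frac1{n_i}\|y_i-X_i^{T}w-Z_i^{T}q\|^2\) (zero if \(n_i=0\)). Source task: \((\tilde w_1,\tilde q_1)\) is a minimizer of \(\mathcal L_1\) if \(p+p_1\le n_1\), and the solution of \(X_1^{T}w+Z_1^{T}q=y_1\)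 with the smallest \(\|w\|^2+\|q\|^2\) if \(p+p_1>n_1\). Let \(L_{\mathrm{co}}=\mathbb E\|w_2-\tilde w_1\|^2\in[0,\infty]\). Target task, Option B: both parts are retrained. \((\tilde w_2,\tilde q_2)\) is a minimizer of \(\mathcal L_2\) if \(p+p_2\le n_2\), and a point of zero training loss to which gradient descent or stochastic gradient descent on \(\mathcal L_2\), started at \((\tilde w_1,0)\), converges if \(p+p_2>n_2\). The model error is \(\mathcal L=\|\tilde w_2-w_2\|^2+\|\tilde q_2-q_2\|^2\). Then: (1) If \(p+p_2>n_2+1\), then almost surely there is exactly one such convergence point from \((\tilde w_1,0)\), \((\tilde w_2,\tilde q_2)\) minimizes \(\|w-\tilde w_1\|^2+\|q\|^2\) subject to \(X_2^{T}w+Z_2^{T}q=y_2\), and \[ \mathbb E[\mathcal L]=\Bigl(1-\frac{n_2}{p+p_2}\Bigr)\bigl(L_{\mathrm{co}}+\|q_2\|^2\bigr)+\frac{n_2\sigma_2^2}{p+p_2-n_2-1}, \] as an identity in \([0,\infty]\). (2) If \(n_2>p+p_2+1\), then \[ \mathbb E[\mathcal L]=\frac{(p+p_2)\,\sigma_2^2}{n_2-(p+p_2)-1}.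 \] -/

import Mathlib

open MeasureTheory ProbabilityTheory Filter Topology
open scoped NNReal ENNReal Matrix

namespace PartialTransfer

/-- Learner's parameters `(w, q)`: `p` common and `m` task-specific ones, with the Euclidean
norm `‖(w, q)‖² = ‖w‖² + ‖q‖²`. -/
abbrev Params (p m : ℕ) : Type :=
  WithLp 2 (EuclideanSpace ℝ (Fin p) × EuclideanSpace ℝ (Fin m))

/-- `n` training samples of one task: the columns of `X` are the common features, the columns of
`Z` the task-specific features, and the entries of `y` the outputs. -/
structure Sample (p m n : ℕ) where
  X : Matrix (Fin p) (Fin n) ℝ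
  Z : Matrix (Fin m) (Fin n) ℝ
  y : Fin n → ℝ

namespace Sample

variable {p m n : ℕ}

/-- The fitted values `Xᵀ w + Zᵀ q`. -/
def fitted (S : Sample p m n) (θ : Params p m) : Fin n → ℝ :=
  S.Xᵀ *ᵥ θ.fst.ofLp + S.Zᵀ *ᵥ θ.snd.ofLp

/-- Mean squared error over the samples in the batch `B`. -/
noncomputable def batchLoss (S : Sample p m n) (B : Finset (Fin n)) (θ : Params p m) : ℝ :=
  (1 / (B.card : ℝ)) * ∑ j ∈ B, (S.y j - S.fitted θ j) ^ 2

/-- The training loss: `(1/n) ‖y - Xᵀ w - Zᵀ q‖²`. -/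
noncomputable def trainLoss (S : Sample p m n) (θ : Params p m) : ℝ :=
  S.batchLoss Finset.univ θ

/-- `θ` minimizes the training loss. -/
def IsLeastSquares (S : Sample p m n) (θ : Params p m) : Prop :=
  ∀ θ' : Params p m, S.trainLoss θ ≤ S.trainLoss θ'

/-- `θ` fits all the samples exactly: `Xᵀ w + Zᵀ q = y`. -/
def Interpolates (S : Sample p m n) (θ : Params p m) : Prop :=
  S.fitted θ = S.y

/-- Among all parameters that fit the samples exactly, `θ` is one at the smallest Euclidean
distance from `θ₀`. -/
def IsClosestInterpolator (S : Sample p m n) (θ₀ θ : Params p m) : Prop :=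
  S.Interpolates θ ∧ ∀ θ' : Params p m, S.Interpolates θ' → ‖θ - θ₀‖ ≤ ‖θ' - θ₀‖

/-- `θ` is the sequence of iterates of (stochastic) gradient descent on the mean squared error,
started at `θ₀`, with learning rate `η k > 0` and batch `B k` in step `k`. Gradient descent is the
case `B k = Finset.univ`, and single-sample SGD the case of one-point batches; an empty batch has
zero loss and moves nothing. -/
def IsGradientDescent (S : Sample p m n) (θ₀ : Params p m) (η : ℕ → ℝ)
    (B : ℕ → Finset (Fin n)) (θ : ℕ → Params p m) : Prop :=
  (∀ k, 0 < η k) ∧ θ 0 = θ₀ ∧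
    ∀ k, θ (k + 1) = θ k - η k • gradient (S.batchLoss (B k)) (θ k)

/-- `θ` is a point with zero training loss to which a run of GD/SGD started at `θ₀` converges. -/
def IsConvergencePoint (S : Sample p m n) (θ₀ θ : Params p m) : Prop :=
  ∃ (η : ℕ → ℝ) (B : ℕ → Finset (Fin n)) (run : ℕ → Params p m),
    S.IsGradientDescent θ₀ η B run ∧ Tendsto run atTop (𝓝 θ) ∧ S.trainLoss θ = 0

/-- Result of training on the source task: the interpolating solution of smallest norm if
`p + m > n`, and a minimizer of the training loss otherwise. -/
def IsSourceSolution (S : Sample p m n) (θ : Params p m) : Prop :=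
  (n < p + m → S.IsClosestInterpolator 0 θ) ∧ (p + m ≤ n → S.IsLeastSquares θ)

/-- Option B of parameter transfer, with transferred common part `w₁`: both parts are retrained on
the target task, giving the GD/SGD convergence point from the initial point `(w₁, 0)` if
`p + m > n`, and a minimizer of the training loss otherwise. -/
def IsOptionB (S : Sample p m n) (w₁ : EuclideanSpace ℝ (Fin p)) (θ : Params p m) : Prop :=
  (n < p + m → S.IsConvergencePoint (WithLp.toLp 2 (w₁, 0)) θ) ∧
    (p + m ≤ n → S.IsLeastSquares θ)

end Sample

/-- The training samples with inputs `X`, `Z` and noise `ε` for the true parameters `θ = (w, q)`: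
`y = Xᵀ w + Zᵀ q + ε`. -/
def samples {p m n : ℕ} (X : Matrix (Fin p) (Fin n) ℝ) (Z : Matrix (Fin m) (Fin n) ℝ)
    (ε : Fin n → ℝ) (w : EuclideanSpace ℝ (Fin p)) (q : EuclideanSpace ℝ (Fin m)) :
    Sample p m n where
  X := X
  Z := Z
  y := Xᵀ *ᵥ w.ofLp + Zᵀ *ᵥ q.ofLp + ε

/-- All the scalar random variables of one task: the entries of `X`, `Z` and `ε`. -/
def entries {Ω : Type*} {p m n : ℕ} (X : Ω → Matrix (Fin p) (Fin n) ℝ)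
    (Z : Ω → Matrix (Fin m) (Fin n) ℝ) (ε : Ω → Fin n → ℝ) :
    (Fin p × Fin n) ⊕ (Fin m × Fin n) ⊕ Fin n → Ω → ℝ
  | .inl (i, j) => fun ω => X ω i j
  | .inr (.inl (i, j)) => fun ω => Z ω i j
  | .inr (.inr j) => fun ω => ε ω j

/-- Every feature is standard Gaussian and every noise term is `N(0, σ²)`. (Independence is
required separately, of all the entries of both tasks together.) -/
structure HasGaussianEntries {Ω : Type*} [MeasurableSpace Ω] (P : Measure Ω) {p m n : ℕ}
    (X : Ω → Matrix (Fin p) (Fin n) ℝ) (Z : Ω → Matrix (Fin m) (Fin n) ℝ)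
    (ε : Ω → Fin n → ℝ) (σ : ℝ≥0) : Prop where
  common : ∀ i j, HasLaw (fun ω => X ω i j) (gaussianReal 0 1) P
  specific : ∀ i j, HasLaw (fun ω => Z ω i j) (gaussianReal 0 1) P
  noise : ∀ j, HasLaw (fun ω => ε ω j) (gaussianReal 0 (σ ^ 2)) P

/-- The model error `‖w̃ - w‖² + ‖q̃ - q‖²` of the learned parameters `θ = (w̃, q̃)`. -/
noncomputable def modelError {p m : ℕ} (w : EuclideanSpace ℝ (Fin p))
    (q : EuclideanSpace ℝ (Fin m)) (θ : Params p m) : ℝ :=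
  ‖θ.fst - w‖ ^ 2 + ‖θ.snd - q‖ ^ 2

/-- The transferring error `E ‖w₂ - w̃₁‖²`, a number in `[0, ∞]`. -/
noncomputable def transferError {Ω : Type*} [MeasurableSpace Ω] (P : Measure Ω) {p : ℕ}
    (w₂ : EuclideanSpace ℝ (Fin p)) (w₁ : Ω → EuclideanSpace ℝ (Fin p)) : ℝ≥0∞ :=
  ∫⁻ ω, ENNReal.ofReal (‖w₂ - w₁ ω‖ ^ 2) ∂P

end PartialTransfer

/-! Stack the common and specific features into one Gaussian design matrix `A` with `d = p + p₂`
rows and `n = n₂` columns, and let `x` be the true target parameters.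

If `n < d`, the Gram matrix `AᵀA` is almost surely invertible. Every (stochastic) gradient is `A`
times a vector, so a convergence point interpolates and differs from its starting point `x₀` by an
element of the range of `A`. By Pythagoras it is the interpolator closest to `x₀`, which is unique,
and gradient descent with a small constant rate reaches it. Its error is `Q (x₀ - x) + A (AᵀA)⁻¹ ε`,
where `Q` projects onto the orthogonal complement of the columns of `A`. The two terms are
orthogonal, so the squared error is `v ⬝ Q v + ε ⬝ (AᵀA)⁻¹ ε` with `v = x₀ - x`
(`interpolator_error_eq`).

Here `v` depends on the source data alone and is independent of `A`. Sign changes and permutations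
of the rows preserve the law of `A`, so `E Q` is a multiple of the identity; since the trace of `Q`
is almost surely `d - n`, the factor is `1 - n/d` (`lintegral_quadraticForm_residualMatrix`).

The noise contributes `σ² E tr (AᵀA)⁻¹`. A diagonal entry of an inverse Gram matrix is the inverse
squared distance from one column to the span of the others (`gram_inv_insertNth_diag`). Given the
others, that distance is the norm of a standard Gaussian vector in dimension `k = d - n + 1`, and
its inverse square has mean `1/(k - 2) = 1/(d - n - 1)` (`lintegral_gram_inv_diag_stdGaussian`).

If `d + 1 < n`, the least squares error is `(AAᵀ)⁻¹ A ε`, with mean square `σ² E tr (AAᵀ)⁻¹`: the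
same computation for the transposed matrix. -/

namespace PartialTransfer

/-! ### Standard Gaussian vectors: projections, the inverse squared norm, null subspaces. -/

section StdGaussian

variable {E : Type*} [NormedAddCommGroup E] [InnerProductSpace ℝ E] [FiniteDimensional ℝ E]
  [MeasurableSpace E] [BorelSpace E]

/-- For `t` in `K`, the inner products of `t` with `x` and with its projection agree, so the
characteristic functions coincide. -/
theorem stdGaussian_map_orthogonalProjection (K : Submodule ℝ E) :
    (stdGaussian E).map K.orthogonalProjectionOnto = stdGaussian K := by
  apply Measure.ext_of_charFun
  ext t
  rw [charFun_stdGaussian, charFun_apply,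
    integral_map (by fun_prop) (by fun_prop)]
  have := charFun_stdGaussian (E := E) (t : E)
  rw [charFun_apply] at this
  simp only [Submodule.coe_norm] at this ⊢
  rw [← this]
  congr 1 with x
  rw [Submodule.inner_orthogonalProjectionOnto_eq_of_mem_right]

theorem integral_exp_neg_mul_sq_gaussianReal {t : ℝ} (ht : 0 ≤ t) :
    ∫ x, Real.exp (-(t * x ^ 2)) ∂(gaussianReal 0 1) = (1 + 2 * t) ^ (-(1 / 2) : ℝ) := by
  rw [integral_gaussianReal_eq_integral_smul (by simp)]
  have h : ∀ x : ℝ, gaussianPDFReal 0 1 x • Real.exp (-(t * x ^ 2)) =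
      (√(2 * Real.pi))⁻¹ * Real.exp (-(1 / 2 + t) * x ^ 2) := by
    intro x
    simp only [gaussianPDFReal, smul_eq_mul, NNReal.coe_one, mul_one, sub_zero]
    rw [mul_assoc, ← Real.exp_add]
    congr 2
    ring
  simp_rw [h]
  rw [integral_const_mul, integral_gaussian, Real.rpow_neg (by positivity),
    ← Real.sqrt_eq_rpow, ← Real.sqrt_inv, ← Real.sqrt_mul (by positivity), ← Real.sqrt_inv]
  congr 1
  have := Real.pi_pos
  field_simp

theorem integrable_exp_neg_mul_norm_sq (μ : Measure E) [IsFiniteMeasure μ] {t : ℝ} (ht : 0 ≤ t) :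
    Integrable (fun x => Real.exp (-(t * ‖x‖ ^ 2))) μ := by
  refine Integrable.of_bound (C := 1) (by fun_prop) (ae_of_all _ fun x => ?_)
  rw [Real.norm_eq_abs, Real.abs_exp, Real.exp_le_one_iff]
  simp only [Left.neg_nonpos_iff]
  positivity

theorem lintegral_exp_neg_mul_norm_sq_stdGaussian {t : ℝ} (ht : 0 ≤ t) :
    ∫⁻ x, ENNReal.ofReal (Real.exp (-(t * ‖x‖ ^ 2))) ∂(stdGaussian E) =
      ENNReal.ofReal ((1 + 2 * t) ^ (-(Module.finrank ℝ E / 2) : ℝ)) := by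
  rw [← ofReal_integral_eq_lintegral_ofReal (integrable_exp_neg_mul_norm_sq _ ht)
    (ae_of_all _ fun x => (Real.exp_pos _).le)]
  congr 1
  rw [stdGaussian, integral_map (Measurable.aemeasurable (by fun_prop)) (by fun_prop)]
  have h : ∀ x : Fin (Module.finrank ℝ E) → ℝ,
      Real.exp (-(t * ‖∑ i, x i • stdOrthonormalBasis ℝ E i‖ ^ 2)) =
        ∏ i, Real.exp (-(t * x i ^ 2)) := by
    intro x
    rw [← Real.exp_sum, ← real_inner_self_eq_norm_sq,
      (stdOrthonormalBasis ℝ E).orthonormal.inner_sum]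
    simp [Finset.mul_sum, sq]
  simp_rw [h]
  rw [integral_fintype_prod_eq_prod (f := fun _ x => Real.exp (-(t * x ^ 2)))]
  simp only [integral_exp_neg_mul_sq_gaussianReal ht, Finset.prod_const, Finset.card_univ,
    Fintype.card_fin]
  rw [← Real.rpow_natCast, ← Real.rpow_mul (by positivity)]
  congr 1
  ring

/-- Turns an inverse moment into an integral of Laplace transforms. In `[0, ∞]` it also covers `s =
0`, where both sides are infinite. -/
theorem lintegral_exp_neg_mul_Ioi {s : ℝ} (hs : 0 ≤ s) :
    ∫⁻ t in Set.Ioi (0 : ℝ), ENNReal.ofReal (Real.exp (-(t * s))) = (ENNReal.ofReal s)⁻¹ := by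
  rcases hs.eq_or_lt with rfl | hs
  · simp
  · have h : IntegrableOn (fun t : ℝ => Real.exp (-(t * s))) (Set.Ioi 0) := by
      have := integrableOn_exp_mul_Ioi (a := -s) (by linarith) 0
      simpa [mul_comm] using this
    rw [← ofReal_integral_eq_lintegral_ofReal h (ae_of_all _ fun x => (Real.exp_pos _).le),
      ← ENNReal.ofReal_inv_of_pos hs]
    have := integral_exp_mul_Ioi (a := -s) (by linarith) 0
    congr 1
    simpa [mul_comm] using this

theorem lintegral_one_add_two_mul_rpow_Ioi {a : ℝ} (ha : 1 < a) :
    ∫⁻ t in Set.Ioi (0 : ℝ), ENNReal.ofReal ((1 + 2 * t) ^ (-a)) =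
      ENNReal.ofReal (1 / (2 * a - 2)) := by
  have hd : ∀ t ∈ Set.Ici (0 : ℝ), HasDerivAt
      (fun t : ℝ => -(1 + 2 * t) ^ (1 - a) / (2 * a - 2)) ((1 + 2 * t) ^ (-a)) t := by
    intro t ht
    have ht' : (0 : ℝ) < 1 + 2 * t := by
      have : (0 : ℝ) ≤ t := ht
      positivity
    have h1 : HasDerivAt (fun t : ℝ => 1 + 2 * t) 2 t := by
      simpa using ((hasDerivAt_id t).const_mul 2).const_add 1
    have h2 := ((h1.rpow_const (p := 1 - a) (Or.inl ht'.ne')).neg).div_const (2 * a - 2)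
    convert! h2 using 1
    rw [show 1 - a - 1 = -a by ring]
    have : 2 * a - 2 ≠ 0 := by linarith
    rw [eq_div_iff this]
    ring
  have hpos : ∀ t ∈ Set.Ioi (0 : ℝ), 0 ≤ (1 + 2 * t) ^ (-a) := by
    intro t ht
    have : (0 : ℝ) < t := ht
    positivity
  have hlim : Tendsto (fun t : ℝ => -(1 + 2 * t) ^ (1 - a) / (2 * a - 2)) atTop (𝓝 0) := by
    have h1 : Tendsto (fun t : ℝ => 1 + 2 * t) atTop atTop :=
      tendsto_atTop_add_const_left _ _ (tendsto_id.const_mul_atTop (by norm_num))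
    have h2 := (tendsto_rpow_neg_atTop (y := a - 1) (by linarith)).comp h1
    have h3 := (h2.neg).div_const (2 * a - 2)
    simpa [Function.comp_def] using h3
  rw [← ofReal_integral_eq_lintegral_ofReal
    (integrableOn_Ioi_deriv_of_nonneg' hd hpos hlim)
    ((ae_restrict_iff' measurableSet_Ioi).2 (ae_of_all _ hpos)),
    integral_Ioi_of_hasDerivAt_of_nonneg' hd hpos hlim]
  congr 1
  simp [neg_div]

/-- Write the inverse as an integral of `exp (-t ‖x‖²)` over `t > 0` and swap the integrals by
Tonelli. In dimension `k` what remains is the integral of `(1 + 2t)^(-k/2)`, which is finite because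
`k/2 > 1`. -/
theorem lintegral_inv_norm_sq_stdGaussian (h : 3 ≤ Module.finrank ℝ E) :
    ∫⁻ x, (ENNReal.ofReal (‖x‖ ^ 2))⁻¹ ∂(stdGaussian E) =
      ENNReal.ofReal (1 / ((Module.finrank ℝ E : ℝ) - 2)) := by
  simp_rw [← lintegral_exp_neg_mul_Ioi (sq_nonneg _)]
  rw [lintegral_lintegral_swap (by fun_prop)]
  have h3 : (3 : ℝ) ≤ Module.finrank ℝ E := by exact_mod_cast h
  rw [setLIntegral_congr_fun measurableSet_Ioi fun t (ht : (0 : ℝ) < t) =>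
    lintegral_exp_neg_mul_norm_sq_stdGaussian (E := E) ht.le,
    lintegral_one_add_two_mul_rpow_Ioi (by linarith)]
  congr 2
  ring

theorem lintegral_inv_norm_sq_orthogonalProjection (K : Submodule ℝ E)
    (h : 3 ≤ Module.finrank ℝ K) :
    ∫⁻ x, (ENNReal.ofReal (‖K.orthogonalProjectionOnto x‖ ^ 2))⁻¹ ∂(stdGaussian E) =
      ENNReal.ofReal (1 / ((Module.finrank ℝ K : ℝ) - 2)) := by
  rw [← lintegral_inv_norm_sq_stdGaussian h, ← stdGaussian_map_orthogonalProjection,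
    lintegral_map (by fun_prop) (by fun_prop)]

/-- A nonzero `a` orthogonal to `K` gives a linear functional that vanishes on `K` and has a
nondegenerate Gaussian law, which has no atom at `0`. -/
theorem stdGaussian_submodule_eq_zero (K : Submodule ℝ E) (hK : K ≠ ⊤) :
    stdGaussian E K = 0 := by
  obtain ⟨a, haK, ha⟩ := (Submodule.ne_bot_iff _).1
    (mt K.orthogonal_eq_bot_iff.1 hK)
  have hlaw : (stdGaussian E).map (fun x => inner ℝ a x) =
      gaussianReal 0 (‖a‖₊ ^ 2) := by
    apply Measure.ext_of_charFun
    ext t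
    rw [charFun_gaussianReal, charFun_apply, integral_map (by fun_prop) (by fun_prop)]
    have := charFun_stdGaussian (E := E) (t • a)
    rw [charFun_apply] at this
    convert this using 2
    · ext x
      simp [real_inner_comm, inner_smul_right, mul_comm]
    · have ht : ((|t| : ℝ) : ℂ) ^ 2 = (t : ℂ) ^ 2 := mod_cast sq_abs t
      simp [norm_smul, mul_pow, ht]
      ring
  have : NullSingletonClass (gaussianReal 0 (‖a‖₊ ^ 2)) :=
    nullSingletonClass_gaussianReal (by simpa using ha)
  have h0 : (stdGaussian E).map (fun x => inner ℝ a x) {0} = 0 := by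
    rw [hlaw]; simp
  rw [Measure.map_apply (by fun_prop) (measurableSet_singleton _)] at h0
  refine measure_mono_null (fun x hx => ?_) h0
  exact Submodule.inner_left_of_mem_orthogonal hx haK

end StdGaussian

/-! ### Measurability of determinants and inverses. -/

section MatrixMeasurability

variable {α ι : Type*} [MeasurableSpace α] [Fintype ι] [DecidableEq ι]

theorem measurable_matrix_det {f : α → Matrix ι ι ℝ} (hf : ∀ i j, Measurable fun x => f x i j) :
    Measurable fun x => (f x).det := by
  simp only [Matrix.det_apply]
  fun_prop

theorem measurable_matrix_inv_apply {f : α → Matrix ι ι ℝ}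
    (hf : ∀ i j, Measurable fun x => f x i j) (i j : ι) :
    Measurable fun x => (f x)⁻¹ i j := by
  simp only [Matrix.inv_def, Ring.inverse_eq_inv', Matrix.smul_apply, Matrix.adjugate_apply,
    smul_eq_mul]
  refine (measurable_matrix_det hf).inv.mul (measurable_matrix_det fun k l => ?_)
  simp only [Matrix.updateRow_apply]
  split_ifs
  · exact measurable_const
  · exact hf k l

end MatrixMeasurability

/-- Integrates over one vector of an i.i.d. family with the others held fixed. -/
theorem lintegral_pi_insertNth {E : Type*} [MeasurableSpace E] {n : ℕ} (j : Fin (n + 1))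
    {f : (Fin (n + 1) → E) → ℝ≥0∞}
    (hf : Measurable f) (μ : Measure E) [SigmaFinite μ] :
    ∫⁻ v, f v ∂(Measure.pi fun _ => μ) =
      ∫⁻ V, ∫⁻ x, f (j.insertNth x V) ∂μ ∂(Measure.pi fun _ : Fin n => μ) := by
  have h := (measurePreserving_piFinSuccAbove (fun _ : Fin (n + 1) => μ) j).symm
  rw [← h.lintegral_comp hf, lintegral_prod_symm' _ (by fun_prop)]
  rfl

theorem linearIndependent_insertNth {E : Type*} [AddCommGroup E] [Module ℝ E] {n : ℕ}
    {j : Fin (n + 1)} {x : E} {V : Fin n → E}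
    (hV : LinearIndependent ℝ V) (hx : x ∉ Submodule.span ℝ (Set.range V)) :
    LinearIndependent ℝ (j.insertNth x V : Fin (n + 1) → E) := by
  have h := linearIndependent_finCons.2 ⟨hV, hx⟩
  have h2 := h.comp _ (j.cycleRange).injective
  rwa [Fin.cons_comp_cycleRange] at h2

/-! ### Gram matrices of Gaussian vectors. -/

section Gram

variable {E : Type*} [NormedAddCommGroup E] [InnerProductSpace ℝ E] [FiniteDimensional ℝ E]

/-- The component `r` of `x` orthogonal to the span of `V` is a combination of the whole family with
coefficient `1` at `j`. If `c` is its coefficient vector, then `G c = ‖r‖² e_j`, since `r` is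
orthogonal to `V` and has inner product `‖r‖²` with `x`. Applying `G⁻¹` and reading coordinate `j`
gives `1 = ‖r‖² (G⁻¹)_jj`. -/
theorem gram_inv_insertNth_diag {n : ℕ} (j : Fin (n + 1)) (x : E) (V : Fin n → E)
    (h : LinearIndependent ℝ (j.insertNth x V : Fin (n + 1) → E)) :
    (Matrix.gram ℝ (j.insertNth x V : Fin (n + 1) → E))⁻¹ j j =
      (‖(Submodule.span ℝ (Set.range V))ᗮ.orthogonalProjectionOnto x‖ ^ 2)⁻¹ := by
  set v : Fin (n + 1) → E := j.insertNth x V with hv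
  set W := Submodule.span ℝ (Set.range V)
  set r : E := (Wᗮ.orthogonalProjectionOnto x : E) with hr
  obtain ⟨c', hc'⟩ := (Submodule.mem_span_range_iff_exists_fun ℝ).1
    (W.orthogonalProjectionOnto x).2
  have hrx : r = x - W.orthogonalProjectionOnto x := by
    rw [hr, eq_sub_iff_add_eq, add_comm]
    exact W.starProjection_add_starProjection_orthogonal x
  have hrW : r ∈ Wᗮ := (Wᗮ.orthogonalProjectionOnto x).2
  set c : Fin (n + 1) → ℝ := j.insertNth 1 (-c') with hc
  have hsum : ∑ i, c i • v i = r := by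
    rw [Fin.sum_univ_succAbove _ j, hrx, ← hc']
    simp [hc, hv, sub_eq_add_neg]
  have hG : Matrix.gram ℝ v *ᵥ c = ‖r‖ ^ 2 • Pi.single j 1 := by
    ext i
    have h1 : (Matrix.gram ℝ v *ᵥ c) i = inner ℝ (v i) r := by
      rw [← hsum, inner_sum]
      simp [Matrix.mulVec, dotProduct, inner_smul_right, mul_comm, Matrix.gram_apply]
    rw [h1]
    refine Fin.succAboveCases j ?_ (fun i => ?_) i
    · have h2 : inner ℝ (W.orthogonalProjectionOnto x : E) r = 0 :=
        Submodule.inner_right_of_mem_orthogonal (W.orthogonalProjectionOnto x).2 hrW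
      have h3 : x = r + W.orthogonalProjectionOnto x := by rw [hrx]; abel
      simp only [hv, Fin.insertNth_apply_same, Pi.smul_apply, Pi.single_eq_same, smul_eq_mul,
        mul_one]
      nth_rw 1 [h3]
      rw [inner_add_left, h2, add_zero, real_inner_self_eq_norm_sq]
    · have h2 : inner ℝ (V i) r = 0 :=
        Submodule.inner_right_of_mem_orthogonal (Submodule.subset_span (Set.mem_range_self i)) hrW
      simp [hv, h2]
  have hdet : IsUnit (Matrix.gram ℝ v).det :=
    ((Matrix.det_gram_ne_zero_iff_linearIndependent).2 h).isUnit
  have h1 : c = (Matrix.gram ℝ v)⁻¹ *ᵥ (‖r‖ ^ 2 • Pi.single j 1) := by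
    rw [← hG, Matrix.mulVec_mulVec, Matrix.nonsing_inv_mul _ hdet, Matrix.one_mulVec]
  have h2 := congrFun h1 j
  rw [Matrix.mulVec_smul, Matrix.mulVec_single_one] at h2
  simp only [hc, Fin.insertNth_apply_same, Pi.smul_apply, Matrix.col_apply, smul_eq_mul] at h2
  change _ = (‖r‖ ^ 2)⁻¹
  exact eq_inv_of_mul_eq_one_right h2.symm

variable [MeasurableSpace E] [BorelSpace E]

theorem measurable_gram_apply {ι : Type*} [Fintype ι] (i j : ι) :
    Measurable fun v : ι → E => Matrix.gram ℝ v i j := by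
  simp only [Matrix.gram_apply]
  fun_prop

/-- By induction: fewer vectors than the dimension span a proper subspace, which the next
independent vector almost surely avoids. -/
theorem ae_linearIndependent_stdGaussian {n : ℕ} (hn : n ≤ Module.finrank ℝ E) :
    ∀ᵐ v ∂(Measure.pi fun _ : Fin n => stdGaussian E), LinearIndependent ℝ v := by
  induction n with
  | zero => exact ae_of_all _ fun v => linearIndependent_empty_type
  | succ n ih =>
    have hmeas : MeasurableSet {v : Fin (n + 1) → E | ¬ LinearIndependent ℝ v} := by
      simp only [← Matrix.det_gram_ne_zero_iff_linearIndependent (𝕜 := ℝ), not_not]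
      exact (measurable_matrix_det measurable_gram_apply) (measurableSet_singleton 0)
    rw [ae_iff, ← lintegral_indicator_one hmeas,
      lintegral_pi_insertNth 0 (measurable_one.indicator hmeas)]
    refine lintegral_eq_zero_of_ae_eq_zero ?_
    filter_upwards [ih (by omega)] with V hV
    have hW : Submodule.span ℝ (Set.range V) ≠ ⊤ := by
      intro h
      have := finrank_range_le_card (R := ℝ) V
      rw [Set.finrank, h, finrank_top, Fintype.card_fin] at this
      omega
    refine lintegral_eq_zero_of_ae_eq_zero ?_
    have h0 : ∀ᵐ x ∂(stdGaussian E), x ∉ Submodule.span ℝ (Set.range V) := by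
      rw [ae_iff]
      simpa using stdGaussian_submodule_eq_zero _ hW
    filter_upwards [h0] with x hx
    simp only [Pi.zero_apply, Set.indicator_apply_eq_zero, Set.mem_ofPred_eq]
    exact fun h => absurd (linearIndependent_insertNth hV hx) h

theorem lintegral_gram_inv_diag_stdGaussian {n : ℕ} (hn : n + 1 < Module.finrank ℝ E)
    (j : Fin n) :
    ∫⁻ v, ENNReal.ofReal ((Matrix.gram ℝ v)⁻¹ j j) ∂(Measure.pi fun _ : Fin n => stdGaussian E) =
      ENNReal.ofReal (1 / ((Module.finrank ℝ E : ℝ) - n - 1)) := by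
  cases n with
  | zero => exact j.elim0
  | succ n =>
    rw [lintegral_pi_insertNth j
      (measurable_matrix_inv_apply measurable_gram_apply j j).ennreal_ofReal]
    rw [lintegral_congr_ae (g := fun _ => ENNReal.ofReal
      (1 / ((Module.finrank ℝ E : ℝ) - (n + 1 : ℕ) - 1)))]
    · simp
    filter_upwards [ae_linearIndependent_stdGaussian (E := E) (n := n) (by omega)] with V hV
    set W := Submodule.span ℝ (Set.range V) with hWdef
    have hdim : Module.finrank ℝ W = n := by
      simpa using finrank_span_eq_card hV
    have hdim' := W.finrank_add_finrank_orthogonal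
    have hW : W ≠ ⊤ := by
      intro h
      rw [h, finrank_top] at hdim
      omega
    have h0 : ∀ᵐ x ∂(stdGaussian E), x ∉ W := by
      rw [ae_iff]
      simpa using stdGaussian_submodule_eq_zero _ hW
    -- With `n + 1` vectors in total, the complement of the other `n` has dimension `finrank E - n`.
    -- This is at least `3` by `hn`, exactly what the inverse moment requires.
    rw [lintegral_congr_ae (g := fun x =>
      (ENNReal.ofReal (‖Wᗮ.orthogonalProjectionOnto x‖ ^ 2))⁻¹)]
    · rw [lintegral_inv_norm_sq_orthogonalProjection _ (by omega)]
      congr 2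
      rw [← hdim', hdim]
      push_cast
      ring
    filter_upwards [h0] with x hx
    rw [gram_inv_insertNth_diag j x V (linearIndependent_insertNth hV hx), ← hWdef,
      ENNReal.ofReal_inv_of_pos]
    have : Wᗮ.orthogonalProjectionOnto x ≠ 0 := by
      intro h
      apply hx
      have := Submodule.orthogonalProjectionOnto_eq_zero_iff.1 h
      rwa [Submodule.orthogonal_orthogonal] at this
    positivity

end Gram

/-- The law of a family of independent standard Gaussian variables. -/
noncomputable abbrev stdPi (ι : Type*) [Fintype ι] : Measure (ι → ℝ) :=
  Measure.pi fun _ => gaussianReal 0 1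

/-- The matrix with given entries. -/
abbrev toMatrix {κ ν : Type*} (a : κ × ν → ℝ) : Matrix κ ν ℝ :=
  Matrix.of fun k j => a (k, j)

theorem measurePreserving_comp_equiv {ι ι' : Type*} [Fintype ι] [Fintype ι'] (g : ι' ≃ ι)
    (μ : ι → Measure ℝ) [∀ i, IsProbabilityMeasure (μ i)] :
    MeasurePreserving (fun a : ι → ℝ => a ∘ g) (Measure.pi μ)
      (Measure.pi fun i => μ (g i)) :=
  (measurePreserving_piCongrLeft μ g).symm

/-! ### From i.i.d. entries to i.i.d. columns, and the mean trace of the inverse Gram matrix. -/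

section Law

variable {κ ν : Type*} [Fintype κ] [Fintype ν]

theorem measurePreserving_curry_stdPi :
    MeasurePreserving (fun (a : ν × κ → ℝ) (j : ν) (k : κ) => a (j, k)) (stdPi (ν × κ))
      (Measure.pi fun _ : ν => stdPi κ) := by
  refine ⟨by fun_prop, ?_⟩
  have := Measure.infinitePi_map_curry (fun (_ : ν) (_ : κ) => gaussianReal 0 1)
  simp only [Measure.infinitePi_eq_pi] at this
  exact this

theorem measurePreserving_columns {n : ℕ} (e : ν ≃ Fin n) :
    MeasurePreserving
      (fun (a : κ × ν → ℝ) (j : Fin n) => WithLp.toLp 2 fun k => a (k, e.symm j))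
      (stdPi (κ × ν)) (Measure.pi fun _ : Fin n => stdGaussian (EuclideanSpace ℝ κ)) := by
  have h1 := measurePreserving_comp_equiv
    ((Equiv.prodCongr e.symm (Equiv.refl κ)).trans (Equiv.prodComm ν κ))
    (fun _ : κ × ν => gaussianReal 0 1)
  have h2 := measurePreserving_curry_stdPi (κ := κ) (ν := Fin n)
  have h3 : MeasurePreserving (WithLp.toLp 2 : (κ → ℝ) → EuclideanSpace ℝ κ) (stdPi κ)
      (stdGaussian (EuclideanSpace ℝ κ)) := ⟨by fun_prop, map_pi_eq_stdGaussian⟩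
  have h4 := measurePreserving_pi (fun _ : Fin n => stdPi κ)
    (fun _ : Fin n => stdGaussian (EuclideanSpace ℝ κ)) (fun _ => h3)
  exact (h4.comp h2).comp h1

theorem gram_columns {κ ν : Type*} [Fintype κ] {n : ℕ} (e : ν ≃ Fin n) (a : κ × ν → ℝ) :
    Matrix.gram ℝ (fun j : Fin n => (WithLp.toLp 2 fun k => a (k, e.symm j) : EuclideanSpace ℝ κ)) =
      ((toMatrix a)ᵀ * toMatrix a).submatrix e.symm e.symm := by
  ext i j
  simp [Matrix.gram_apply, Matrix.mul_apply, PiLp.inner_apply, mul_comm]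

variable [DecidableEq ν]

theorem ae_det_transpose_mul_ne_zero (h : Fintype.card ν ≤ Fintype.card κ) :
    ∀ᵐ a ∂(stdPi (κ × ν)), ((toMatrix a)ᵀ * toMatrix a).det ≠ 0 := by
  have e := Fintype.equivFin ν
  have h1 := ae_linearIndependent_stdGaussian (E := EuclideanSpace ℝ κ) (n := Fintype.card ν)
    (by simpa using h)
  filter_upwards [(measurePreserving_columns (κ := κ) e).quasiMeasurePreserving.ae h1] with a ha
  rw [← Matrix.det_gram_ne_zero_iff_linearIndependent (𝕜 := ℝ), gram_columns,
    Matrix.det_submatrix_equiv_self] at ha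
  exact ha

theorem posSemidef_inv_transpose_mul {κ ν : Type*} [Fintype κ] [Fintype ν] [DecidableEq ν]
    (A : Matrix κ ν ℝ) : (Aᵀ * A)⁻¹.PosSemidef := by
  have := Matrix.posSemidef_conjTranspose_mul_self A
  rw [Matrix.conjTranspose_eq_transpose_of_trivial] at this
  exact this.inv

theorem lintegral_trace_inv_transpose_mul (h : Fintype.card ν + 1 < Fintype.card κ) :
    ∫⁻ a, ENNReal.ofReal ((toMatrix a)ᵀ * toMatrix a)⁻¹.trace ∂(stdPi (κ × ν)) =
      ENNReal.ofReal ((Fintype.card ν : ℝ) / ((Fintype.card κ : ℝ) - Fintype.card ν - 1)) := by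
  have e := Fintype.equivFin ν
  have hm : ∀ j, Measurable fun v : Fin (Fintype.card ν) → EuclideanSpace ℝ κ =>
      ENNReal.ofReal ((Matrix.gram ℝ v)⁻¹ j j) := fun j =>
    (measurable_matrix_inv_apply measurable_gram_apply j j).ennreal_ofReal
  have h1 : ∀ a : κ × ν → ℝ, ENNReal.ofReal ((toMatrix a)ᵀ * toMatrix a)⁻¹.trace =
      ∑ j, ENNReal.ofReal ((Matrix.gram ℝ
        (fun j => (WithLp.toLp 2 fun k => a (k, e.symm j) : EuclideanSpace ℝ κ)))⁻¹ j j) := by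
    intro a
    rw [gram_columns, Matrix.inv_submatrix_equiv, Matrix.trace]
    refine (ENNReal.ofReal_sum_of_nonneg
      (fun i _ => (posSemidef_inv_transpose_mul _).diag_nonneg)).trans ?_
    exact (e.symm.sum_comp _).symm
  simp_rw [h1]
  rw [(measurePreserving_columns (κ := κ) e).lintegral_comp
    (f := fun v => ∑ j, ENNReal.ofReal ((Matrix.gram ℝ v)⁻¹ j j))
    (Finset.measurable_sum _ fun j _ => hm j),
    lintegral_finsetSum _ fun j _ => hm j]
  have hd : Module.finrank ℝ (EuclideanSpace ℝ κ) = Fintype.card κ := by simp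
  simp_rw [lintegral_gram_inv_diag_stdGaussian (E := EuclideanSpace ℝ κ) (hd ▸ h), hd]
  rw [Finset.sum_const, Finset.card_univ, Fintype.card_fin, ← ENNReal.ofReal_nsmul, nsmul_eq_mul,
    mul_one_div]

end Law

/-! ### Mean of a quadratic form in Gaussian noise. -/

section QuadraticForm

variable {ν : Type*} [Fintype ν] [DecidableEq ν]

theorem integral_mul_pi_gaussianReal (v : ℝ≥0) (i j : ν) :
    Integrable (fun ε : ν → ℝ => ε i * ε j) (Measure.pi fun _ => gaussianReal 0 v) ∧
      ∫ ε : ν → ℝ, ε i * ε j ∂(Measure.pi fun _ => gaussianReal 0 v) =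
        if i = j then (v : ℝ) else 0 := by
  have hlp : ∀ i, MemLp (fun ε : ν → ℝ => ε i) 2 (Measure.pi fun _ => gaussianReal 0 v) := fun i =>
    (memLp_id_gaussianReal' 2 (by simp)).comp_measurePreserving
      (measurePreserving_eval (fun _ : ν => gaussianReal 0 v) i)
  have hmean : ∀ i, ∫ ε : ν → ℝ, ε i ∂(Measure.pi fun _ => gaussianReal 0 v) = 0 := by
    intro i
    have := integral_map (μ := Measure.pi fun _ : ν => gaussianReal 0 v)
      (measurable_pi_apply i).aemeasurable (f := fun x : ℝ => x) (by fun_prop)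
    rw [← this, (measurePreserving_eval (fun _ : ν => gaussianReal 0 v) i).map_eq,
      integral_id_gaussianReal]
  refine ⟨(hlp i).integrable_mul (hlp j), ?_⟩
  split_ifs with hij
  · subst hij
    have := integral_map (μ := Measure.pi fun _ : ν => gaussianReal 0 v)
      (measurable_pi_apply i).aemeasurable (f := fun x : ℝ => x * x) (by fun_prop)
    rw [← this, (measurePreserving_eval (fun _ : ν => gaussianReal 0 v) i).map_eq,
      ← variance_fun_id_gaussianReal (μ := 0) (v := v),
      variance_of_integral_eq_zero (by fun_prop) integral_id_gaussianReal]
    simp only [sq]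
  · have hind := (iIndepFun_pi (μ := fun _ : ν => gaussianReal 0 v) (X := fun _ x => x)
      (fun _ => aemeasurable_id)).indepFun hij
    have := hind.integral_fun_mul_eq_mul_integral
      (measurable_pi_apply i).aestronglyMeasurable (measurable_pi_apply j).aestronglyMeasurable
    rw [this, hmean, zero_mul]

theorem lintegral_quadraticForm_pi_gaussianReal (v : ℝ≥0) {M : Matrix ν ν ℝ}
    (hM : M.PosSemidef) :
    ∫⁻ ε, ENNReal.ofReal (ε ⬝ᵥ M *ᵥ ε) ∂(Measure.pi fun _ : ν => gaussianReal 0 v) =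
      ENNReal.ofReal (v * M.trace) := by
  have h1 : ∀ ε : ν → ℝ, ε ⬝ᵥ M *ᵥ ε = ∑ i, ∑ j, M i j * (ε i * ε j) := by
    intro ε
    simp only [dotProduct, Matrix.mulVec, Finset.mul_sum]
    exact Finset.sum_congr rfl fun i _ => Finset.sum_congr rfl fun j _ => by ring
  have hint : ∀ i j, Integrable (fun ε : ν → ℝ => M i j * (ε i * ε j))
      (Measure.pi fun _ => gaussianReal 0 v) := fun i j =>
    (integral_mul_pi_gaussianReal v i j).1.const_mul _
  rw [← ofReal_integral_eq_lintegral_ofReal]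
  · congr 1
    simp_rw [h1]
    rw [integral_finsetSum _ fun i _ => integrable_finsetSum _ fun j _ => hint i j]
    simp_rw [integral_finsetSum _ fun j _ => hint _ j, integral_const_mul,
      (integral_mul_pi_gaussianReal v _ _).2]
    simp [Matrix.trace, Finset.mul_sum, mul_comm]
  · simp_rw [h1]
    exact integrable_finsetSum _ fun i _ => integrable_finsetSum _ fun j _ => hint i j
  · refine ae_of_all _ fun ε => ?_
    simpa using hM.dotProduct_mulVec_nonneg ε

end QuadraticForm

/-! ### The projection off the column space and its mean. -/

section Residual

variable {κ ν : Type*} [Fintype κ] [DecidableEq κ] [Fintype ν] [DecidableEq ν]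

/-- The orthogonal projection onto the orthogonal complement of the column space of `A`, provided
that the columns of `A` are linearly independent. -/
noncomputable def residualMatrix (A : Matrix κ ν ℝ) : Matrix κ κ ℝ :=
  1 - A * (Aᵀ * A)⁻¹ * Aᵀ

theorem transpose_residualMatrix (A : Matrix κ ν ℝ) : (residualMatrix A)ᵀ = residualMatrix A := by
  simp [residualMatrix, Matrix.transpose_nonsing_inv, Matrix.mul_assoc]

/-- No rank condition is needed: a singular `AᵀA` has inverse `0` by convention, and the matrix is
then the identity. Positivity and the entry bound therefore hold everywhere, not just almost surely.
-/
theorem residualMatrix_mul_self (A : Matrix κ ν ℝ) :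
    residualMatrix A * residualMatrix A = residualMatrix A := by
  have h : (Aᵀ * A)⁻¹ * (Aᵀ * A) * (Aᵀ * A)⁻¹ = (Aᵀ * A)⁻¹ := by
    by_cases hd : IsUnit (Aᵀ * A).det
    · rw [Matrix.nonsing_inv_mul _ hd, Matrix.one_mul]
    · simp [Matrix.nonsing_inv_apply_not_isUnit _ hd]
  have hP : A * (Aᵀ * A)⁻¹ * Aᵀ * (A * (Aᵀ * A)⁻¹ * Aᵀ) = A * (Aᵀ * A)⁻¹ * Aᵀ := by
    calc _ = A * ((Aᵀ * A)⁻¹ * (Aᵀ * A) * (Aᵀ * A)⁻¹) * Aᵀ := by simp only [Matrix.mul_assoc]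
      _ = _ := by rw [h]
  simp only [residualMatrix, Matrix.sub_mul, Matrix.mul_sub, hP, Matrix.one_mul, Matrix.mul_one]
  abel

theorem posSemidef_residualMatrix (A : Matrix κ ν ℝ) : (residualMatrix A).PosSemidef := by
  have := Matrix.posSemidef_conjTranspose_mul_self (residualMatrix A)
  rwa [Matrix.conjTranspose_eq_transpose_of_trivial, transpose_residualMatrix,
    residualMatrix_mul_self] at this

/-- For a symmetric idempotent, `Q_kk` is the sum of the squares of row `k`. Hence `Q_kk² ≤ Q_kk ≤
1`, and every entry of the row has square at most `1`. This supplies integrability. -/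
theorem abs_residualMatrix_le (A : Matrix κ ν ℝ) (k l : κ) : |residualMatrix A k l| ≤ 1 := by
  have h : ∀ m, residualMatrix A k m ^ 2 ≤ residualMatrix A k k := by
    intro m
    have h1 : residualMatrix A k k = ∑ m, residualMatrix A k m ^ 2 := by
      conv_lhs => rw [← residualMatrix_mul_self, Matrix.mul_apply]
      refine Finset.sum_congr rfl fun m _ => ?_
      have : residualMatrix A m k = residualMatrix A k m :=
        congrFun₂ (transpose_residualMatrix A) k m
      rw [sq, this]
    rw [h1]
    exact Finset.single_le_sum (f := fun m => residualMatrix A k m ^ 2)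
      (fun _ _ => sq_nonneg _) (Finset.mem_univ m)
  have h1 : residualMatrix A k k ≤ 1 := by nlinarith [h k]
  exact abs_le_one_iff_mul_self_le_one.2 (by nlinarith [h l])

theorem trace_residualMatrix (A : Matrix κ ν ℝ) (h : (Aᵀ * A).det ≠ 0) :
    (residualMatrix A).trace = Fintype.card κ - Fintype.card ν := by
  rw [residualMatrix, Matrix.trace_sub, Matrix.trace_one, Matrix.mul_assoc, Matrix.trace_mul_comm,
    Matrix.mul_assoc, Matrix.nonsing_inv_mul _ h.isUnit, Matrix.trace_one]

theorem residualMatrix_orthogonal_mul (A : Matrix κ ν ℝ) {O : Matrix κ κ ℝ} (hO : Oᵀ * O = 1) :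
    residualMatrix (O * A) = O * residualMatrix A * Oᵀ := by
  have hO' : O * Oᵀ = 1 := mul_eq_one_comm.1 hO
  have h : (O * A)ᵀ * (O * A) = Aᵀ * A := by
    rw [Matrix.transpose_mul, Matrix.mul_assoc, ← Matrix.mul_assoc Oᵀ, hO, Matrix.one_mul]
  rw [residualMatrix, residualMatrix, h, Matrix.mul_sub, Matrix.sub_mul, Matrix.mul_one, hO',
    Matrix.transpose_mul]
  simp only [Matrix.mul_assoc]

theorem measurable_residualMatrix_toMatrix (k l : κ) :
    Measurable fun a : κ × ν → ℝ => residualMatrix (toMatrix a) k l := by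
  have h : ∀ i j, Measurable fun a : κ × ν → ℝ => ((toMatrix a)ᵀ * toMatrix a)⁻¹ i j := by
    refine measurable_matrix_inv_apply fun i j => ?_
    simp only [Matrix.mul_apply, Matrix.transpose_apply, Matrix.of_apply]
    fun_prop
  simp only [residualMatrix, Matrix.sub_apply, Matrix.mul_apply, Matrix.transpose_apply,
    Matrix.of_apply]
  refine measurable_const.sub (Finset.measurable_fun_sum _ fun j _ => ?_)
  refine Measurable.fun_mul (Finset.measurable_fun_sum _ fun i _ => ?_) (measurable_pi_apply _)
  exact Measurable.fun_mul (measurable_pi_apply _) (h i j)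

theorem integrable_residualMatrix_toMatrix (k l : κ) :
    Integrable (fun a : κ × ν → ℝ => residualMatrix (toMatrix a) k l) (stdPi (κ × ν)) :=
  Integrable.of_bound (measurable_residualMatrix_toMatrix k l).aestronglyMeasurable 1
    (ae_of_all _ fun _ => abs_residualMatrix_le _ _ _)

/-- Changing the sign of row `k` of the Gaussian matrix preserves its law and negates this entry, so
the mean equals its own negative. -/
theorem integral_residualMatrix_off_diag {k l : κ} (hkl : k ≠ l) :
    ∫ a : κ × ν → ℝ, residualMatrix (toMatrix a) k l ∂(stdPi (κ × ν)) = 0 := by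
  set s : κ → ℝ := Function.update 1 k (-1) with hs
  have hs2 : ∀ i, s i * s i = 1 := by
    intro i
    by_cases hi : i = k
    · subst hi; simp [hs]
    · simp [hs, hi]
  have hmp : MeasurePreserving (fun (a : κ × ν → ℝ) (x : κ × ν) => s x.1 * a x)
      (stdPi (κ × ν)) (stdPi (κ × ν)) := by
    refine measurePreserving_pi _ _ fun x => ⟨by fun_prop, ?_⟩
    rw [gaussianReal_map_const_mul]
    congr 1
    · simp
    · ext
      simp [sq, hs2]
  have hO : (Matrix.diagonal s)ᵀ * Matrix.diagonal s = 1 := by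
    rw [Matrix.diagonal_transpose, Matrix.diagonal_mul_diagonal]
    simp [hs2]
  have hneg : ∀ a : κ × ν → ℝ, residualMatrix (toMatrix fun x => s x.1 * a x) k l =
      -residualMatrix (toMatrix a) k l := by
    intro a
    have h1 : (toMatrix fun x : κ × ν => s x.1 * a x) = Matrix.diagonal s * toMatrix a := by
      ext i j
      simp
    rw [h1, residualMatrix_orthogonal_mul _ hO, Matrix.diagonal_transpose, Matrix.mul_diagonal,
      Matrix.diagonal_mul]
    simp [hs, hkl.symm]
  have h1 := integral_map (μ := stdPi (κ × ν)) hmp.measurable.aemeasurable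
    (measurable_residualMatrix_toMatrix k l).aestronglyMeasurable
  rw [hmp.map_eq] at h1
  simp_rw [hneg] at h1
  rw [integral_neg] at h1
  linarith

/-- Swapping rows `k` and `l` preserves the law and exchanges the two diagonal entries. -/
theorem integral_residualMatrix_diag_eq (k l : κ) :
    ∫ a : κ × ν → ℝ, residualMatrix (toMatrix a) k k ∂(stdPi (κ × ν)) =
      ∫ a : κ × ν → ℝ, residualMatrix (toMatrix a) l l ∂(stdPi (κ × ν)) := by
  have hmp := measurePreserving_comp_equiv ((Equiv.swap k l).prodCongr (Equiv.refl ν))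
    (fun _ : κ × ν => gaussianReal 0 1)
  have h1 := integral_map (μ := stdPi (κ × ν)) hmp.measurable.aemeasurable
    (measurable_residualMatrix_toMatrix k k).aestronglyMeasurable
  rw [hmp.map_eq] at h1
  rw [h1]
  congr 1 with a
  have h2 : toMatrix (a ∘ ((Equiv.swap k l).prodCongr (Equiv.refl ν))) =
      (toMatrix a).submatrix (Equiv.swap k l) (Equiv.refl ν) := by
    ext i j
    simp
  have h3 : residualMatrix ((toMatrix a).submatrix (Equiv.swap k l) (Equiv.refl ν)) =
      (residualMatrix (toMatrix a)).submatrix (Equiv.swap k l) (Equiv.swap k l) := by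
    simp only [residualMatrix, Matrix.transpose_submatrix, Matrix.submatrix_mul_equiv,
      Matrix.inv_submatrix_equiv]
    ext i j
    simp [Matrix.one_apply]
  rw [h2, h3]
  simp

/-- The diagonal means are all equal and add up to the almost surely constant trace. -/
theorem integral_residualMatrix_diag (h : Fintype.card ν ≤ Fintype.card κ) (k : κ) :
    ∫ a : κ × ν → ℝ, residualMatrix (toMatrix a) k k ∂(stdPi (κ × ν)) =
      1 - (Fintype.card ν : ℝ) / Fintype.card κ := by
  have h1 : ∑ l, ∫ a : κ × ν → ℝ, residualMatrix (toMatrix a) l l ∂(stdPi (κ × ν)) =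
      (Fintype.card κ : ℝ) - Fintype.card ν := by
    rw [← integral_finsetSum _ fun l _ => integrable_residualMatrix_toMatrix l l]
    have : ∀ᵐ a ∂(stdPi (κ × ν)), ∑ l, residualMatrix (toMatrix a) l l =
        (Fintype.card κ : ℝ) - Fintype.card ν := by
      filter_upwards [ae_det_transpose_mul_ne_zero h] with a ha
      exact trace_residualMatrix _ ha
    rw [integral_congr_ae this]
    simp
  simp_rw [fun l => integral_residualMatrix_diag_eq (ν := ν) l k] at h1
  rw [Finset.sum_const, Finset.card_univ, nsmul_eq_mul] at h1
  have : (Fintype.card κ : ℝ) ≠ 0 := by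
    have := Fintype.card_pos_iff.2 ⟨k⟩
    positivity
  field_simp
  linarith

theorem lintegral_quadraticForm_residualMatrix (h : Fintype.card ν ≤ Fintype.card κ)
    (v : κ → ℝ) :
    ∫⁻ a, ENNReal.ofReal (v ⬝ᵥ residualMatrix (toMatrix a) *ᵥ v) ∂(stdPi (κ × ν)) =
      ENNReal.ofReal (1 - (Fintype.card ν : ℝ) / Fintype.card κ) * ENNReal.ofReal (v ⬝ᵥ v) := by
  have h1 : ∀ a : κ × ν → ℝ, v ⬝ᵥ residualMatrix (toMatrix a) *ᵥ v =
      ∑ k, ∑ l, v k * v l * residualMatrix (toMatrix a) k l := by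
    intro a
    simp only [dotProduct, Matrix.mulVec, Finset.mul_sum]
    exact Finset.sum_congr rfl fun i _ => Finset.sum_congr rfl fun j _ => by ring
  have hint : ∀ k l, Integrable
      (fun a : κ × ν → ℝ => v k * v l * residualMatrix (toMatrix a) k l) (stdPi (κ × ν)) :=
    fun k l => (integrable_residualMatrix_toMatrix k l).const_mul _
  have hE : ∀ k l, ∫ a : κ × ν → ℝ, residualMatrix (toMatrix a) k l ∂(stdPi (κ × ν)) =
      if k = l then 1 - (Fintype.card ν : ℝ) / Fintype.card κ else 0 := by
    intro k l
    split_ifs with hkl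
    · subst hkl
      exact integral_residualMatrix_diag h k
    · exact integral_residualMatrix_off_diag hkl
  have hc : 0 ≤ 1 - (Fintype.card ν : ℝ) / Fintype.card κ :=
    sub_nonneg.2 (div_le_one_of_le₀ (by exact_mod_cast h) (by positivity))
  rw [← ofReal_integral_eq_lintegral_ofReal, ← ENNReal.ofReal_mul hc]
  · congr 1
    simp_rw [h1]
    rw [integral_finsetSum _ fun i _ => integrable_finsetSum _ fun j _ => hint i j]
    simp_rw [integral_finsetSum _ fun j _ => hint _ j, integral_const_mul, hE]
    simp [dotProduct, Finset.mul_sum, mul_comm]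
  · simp_rw [h1]
    exact integrable_finsetSum _ fun i _ => integrable_finsetSum _ fun j _ => hint i j
  · refine ae_of_all _ fun a => ?_
    simpa using (posSemidef_residualMatrix (toMatrix a)).dotProduct_mulVec_nonneg v

end Residual

/-! ### Parameters as plain vectors, and linear algebra for gradient descent. -/

section Params

variable {p m n : ℕ}

/-- The parameters `(w, q)` as one vector. -/
def paramsEquiv (p m : ℕ) : Params p m ≃ₗ[ℝ] (Fin p ⊕ Fin m → ℝ) where
  toFun θ := Sum.elim θ.fst.ofLp θ.snd.ofLp
  invFun x := WithLp.toLp 2 (WithLp.toLp 2 (x ∘ Sum.inl), WithLp.toLp 2 (x ∘ Sum.inr))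
  map_add' θ θ' := by ext (i | i) <;> simp
  map_smul' c θ := by ext (i | i) <;> simp
  left_inv _ := rfl
  right_inv x := by ext (i | i) <;> simp

theorem paramsEquiv_apply (θ : Params p m) :
    paramsEquiv p m θ = Sum.elim θ.fst.ofLp θ.snd.ofLp := rfl

theorem inner_params (θ θ' : Params p m) :
    inner ℝ θ θ' = paramsEquiv p m θ ⬝ᵥ paramsEquiv p m θ' := by
  simp [paramsEquiv_apply, dotProduct, WithLp.prod_inner_apply, PiLp.inner_apply, mul_comm]

theorem norm_sq_params (θ : Params p m) :
    ‖θ‖ ^ 2 = paramsEquiv p m θ ⬝ᵥ paramsEquiv p m θ := by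
  rw [← inner_params, real_inner_self_eq_norm_sq]

theorem modelError_eq (w : EuclideanSpace ℝ (Fin p)) (q : EuclideanSpace ℝ (Fin m))
    (θ : Params p m) :
    modelError w q θ = (paramsEquiv p m θ - Sum.elim w.ofLp q.ofLp) ⬝ᵥ
      (paramsEquiv p m θ - Sum.elim w.ofLp q.ofLp) := by
  simp only [modelError, EuclideanSpace.real_norm_sq_eq]
  simp [paramsEquiv_apply, dotProduct, sq]

end Params

theorem isClosed_of_finiteDimensional {E : Type*} [NormedAddCommGroup E] [NormedSpace ℝ E]
    [FiniteDimensional ℝ E] (K : Submodule ℝ E) : IsClosed (K : Set E) :=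
  K.closed_of_finiteDimensional

theorem exists_dotProduct_mulVec_self_le {κ ν : Type*} [Fintype κ] [Fintype ν]
    (B : Matrix κ ν ℝ) : ∃ C > 0, ∀ x, (B *ᵥ x) ⬝ᵥ (B *ᵥ x) ≤ C * (x ⬝ᵥ x) := by
  -- The squared Frobenius norm suffices for the bound; adding `1` keeps the constant positive when
  -- `B = 0`.
  refine ⟨∑ i, ∑ j, B i j ^ 2 + 1, by positivity, fun x => ?_⟩
  have hx : 0 ≤ x ⬝ᵥ x := Finset.sum_nonneg fun i _ => mul_self_nonneg _
  have : (B *ᵥ x) ⬝ᵥ (B *ᵥ x) ≤ (∑ i, ∑ j, B i j ^ 2) * (x ⬝ᵥ x) := by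
    rw [Finset.sum_mul]
    refine Finset.sum_le_sum fun i _ => ?_
    have := Finset.sum_mul_sq_le_sq_mul_sq Finset.univ (B i) x
    simpa [dotProduct, Matrix.mulVec, sq] using this
  linarith

theorem mulVec_inv_mulVec {ν : Type*} [Fintype ν] [DecidableEq ν] {G : Matrix ν ν ℝ}
    (hG : G.det ≠ 0) (x : ν → ℝ) : G *ᵥ G⁻¹ *ᵥ x = x := by
  rw [Matrix.mulVec_mulVec, Matrix.mul_nonsing_inv _ hG.isUnit, Matrix.one_mulVec]

theorem inv_mulVec_mulVec {ν : Type*} [Fintype ν] [DecidableEq ν] {G : Matrix ν ν ℝ}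
    (hG : G.det ≠ 0) (x : ν → ℝ) : G⁻¹ *ᵥ G *ᵥ x = x := by
  rw [Matrix.mulVec_mulVec, Matrix.nonsing_inv_mul _ hG.isUnit, Matrix.one_mulVec]

theorem dotProduct_self_nonneg_real {ν : Type*} [Fintype ν] (x : ν → ℝ) : 0 ≤ x ⬝ᵥ x :=
  Finset.sum_nonneg fun i _ => mul_self_nonneg (x i)

/-- Repeated multiplication by `1 - s G` contracts to `0` for a Gram matrix `G = Aᵀ A` of full rank
and a suitable `s > 0`. -/
theorem exists_contraction_gram {κ ν : Type*} [Fintype κ] [Fintype ν] [DecidableEq ν]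
    (A : Matrix κ ν ℝ) (hG : (Aᵀ * A).det ≠ 0) :
    ∃ s > (0 : ℝ), ∃ ρ, 0 ≤ ρ ∧ ρ < 1 ∧ ∀ c,
      (c - s • (Aᵀ * A) *ᵥ c) ⬝ᵥ (c - s • (Aᵀ * A) *ᵥ c) ≤ ρ * (c ⬝ᵥ c) := by
  -- Boundedness of this left inverse of `A` gives `|c|² ≤ C |A c|²`, hence `c ⬝ G c ≥ |c|² / C`.
  obtain ⟨C, hC, hC'⟩ := exists_dotProduct_mulVec_self_le ((Aᵀ * A)⁻¹ * Aᵀ)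
  obtain ⟨M, hM, hM'⟩ := exists_dotProduct_mulVec_self_le (Aᵀ * A)
  set m := 1 / C with hm
  have hmpos : 0 < m := by positivity
  -- With step `m / K` the squared norm is at most `1 - 2m²/K + m²/K = 1 - m²/K` times `|c|²`,
  -- because `|G c|² ≤ K |c|²`. The summand `m²` in `K` makes this factor nonnegative.
  set K := M + m ^ 2 with hK
  have hKpos : 0 < K := by positivity
  refine ⟨m / K, by positivity, 1 - m ^ 2 / K, ?_, ?_, fun c => ?_⟩
  · rw [sub_nonneg, div_le_one hKpos]
    linarith
  · have : 0 < m ^ 2 / K := by positivity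
    linarith
  · have hc := dotProduct_self_nonneg_real c
    have h1 : m * (c ⬝ᵥ c) ≤ c ⬝ᵥ (Aᵀ * A) *ᵥ c := by
      have h2 := hC' (A *ᵥ c)
      rw [Matrix.mulVec_mulVec, Matrix.mul_assoc, Matrix.nonsing_inv_mul _ hG.isUnit,
        Matrix.one_mulVec] at h2
      have h3 : c ⬝ᵥ (Aᵀ * A) *ᵥ c = (A *ᵥ c) ⬝ᵥ (A *ᵥ c) := by
        rw [← Matrix.mulVec_mulVec, Matrix.dotProduct_mulVec, Matrix.vecMul_transpose]
      rw [h3, hm, div_mul_eq_mul_div, one_mul, div_le_iff₀ hC]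
      linarith
    have h4 := hM' c
    set g := (Aᵀ * A) *ᵥ c
    have h5 : (c - (m / K) • g) ⬝ᵥ (c - (m / K) • g) =
        c ⬝ᵥ c - 2 * (m / K) * (c ⬝ᵥ g) + (m / K) ^ 2 * (g ⬝ᵥ g) := by
      simp only [sub_dotProduct, dotProduct_sub, smul_dotProduct, dotProduct_smul, smul_eq_mul,
        dotProduct_comm g c]
      ring
    have hmK : 0 ≤ m / K := by positivity
    have h6 : g ⬝ᵥ g ≤ K * (c ⬝ᵥ c) := by nlinarith [sq_nonneg m]
    have h7 := mul_le_mul_of_nonneg_left h1 hmK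
    have h8 := mul_le_mul_of_nonneg_left h6 (sq_nonneg (m / K))
    have h9 : (m / K) ^ 2 * (K * (c ⬝ᵥ c)) = m ^ 2 / K * (c ⬝ᵥ c) := by
      field_simp
    have h10 : m / K * (m * (c ⬝ᵥ c)) = m ^ 2 / K * (c ⬝ᵥ c) := by
      field_simp
    rw [h5]
    nlinarith

/-! ### Convergence points, closest interpolators and least squares for fixed samples. -/

namespace Sample

variable {p m n : ℕ} (S : Sample p m n)

/-- The design matrix, whose columns are the full feature vectors. -/
def design : Matrix (Fin p ⊕ Fin m) (Fin n) ℝ := Matrix.fromRows S.X S.Z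

theorem fitted_eq (θ : Params p m) : S.fitted θ = S.designᵀ *ᵥ paramsEquiv p m θ := by
  ext j
  simp [fitted, design, paramsEquiv_apply, Matrix.mulVec, dotProduct]

theorem interpolates_of_trainLoss_eq_zero {θ : Params p m} (h : S.trainLoss θ = 0) :
    S.Interpolates θ := by
  ext j
  have hn : (n : ℝ) ≠ 0 := by
    have := j.pos
    positivity
  simp only [trainLoss, batchLoss, Finset.card_univ, Fintype.card_fin, mul_eq_zero, div_eq_zero_iff,
    one_ne_zero, hn, or_self, false_or] at h
  have := (Finset.sum_eq_zero_iff_of_nonneg fun i _ => sq_nonneg _).1 h j (Finset.mem_univ j)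
  nlinarith [this]

theorem trainLoss_eq_zero_of_interpolates {θ : Params p m} (h : S.Interpolates θ) :
    S.trainLoss θ = 0 := by
  have h' : S.fitted θ = S.y := h
  simp [trainLoss, batchLoss, h']

theorem gradient_batchLoss (B : Finset (Fin n)) (θ : Params p m) :
    paramsEquiv p m (gradient (S.batchLoss B) θ) =
      S.design *ᵥ fun j => if j ∈ B then (2 / (B.card : ℝ)) * (S.fitted θ j - S.y j) else 0 := by
  set u : Fin n → Params p m := fun j => (paramsEquiv p m).symm (S.design.col j) with hu
  have hfit : ∀ θ j, S.fitted θ j = inner ℝ (u j) θ := by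
    intro θ j
    rw [inner_params, hu, LinearEquiv.apply_symm_apply, fitted_eq]
    rfl
  set c : Fin n → ℝ := fun j =>
    if j ∈ B then (2 / (B.card : ℝ)) * (S.fitted θ j - S.y j) else 0 with hc
  have hgrad : HasGradientAt (S.batchLoss B) (∑ j, c j • u j) θ := by
    rw [hasGradientAt_iff_hasFDerivAt]
    have h1 : ∀ j, HasFDerivAt (fun θ => (S.y j - S.fitted θ j) ^ 2)
        ((2 * (S.fitted θ j - S.y j)) • innerSL ℝ (u j)) θ := by
      intro j
      simp_rw [hfit]
      have h2 := (((innerSL ℝ (u j)).hasFDerivAt (x := θ)).const_sub (S.y j)).pow 2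
      refine h2.congr_fderiv ?_
      ext x
      simp
      ring
    have h2 := (HasFDerivAt.fun_sum fun j (_ : j ∈ B) => h1 j).const_mul (1 / (B.card : ℝ))
    refine h2.congr_fderiv ?_
    ext x
    simp [hc, Finset.mul_sum, Finset.sum_ite_mem]
    refine Finset.sum_congr rfl fun j _ => by ring
  rw [hgrad.gradient, map_sum]
  ext i
  simp [hu, Matrix.mulVec, dotProduct, mul_comm]

variable {S}

theorem IsConvergencePoint.interpolates {θ₀ θ : Params p m} (h : S.IsConvergencePoint θ₀ θ) :
    S.Interpolates θ := by
  obtain ⟨-, -, -, -, -, h⟩ := h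
  exact S.interpolates_of_trainLoss_eq_zero h

/-- Every step moves within the range of the design matrix, whatever the batches and learning rates.
The range is closed, being finite-dimensional, so the limit stays in it. -/
theorem IsConvergencePoint.exists_eq_mulVec {θ₀ θ : Params p m}
    (h : S.IsConvergencePoint θ₀ θ) : ∃ c, paramsEquiv p m (θ - θ₀) = S.design *ᵥ c := by
  obtain ⟨η, B, run, ⟨-, h0, hstep⟩, hlim, -⟩ := h
  set K : Submodule ℝ (Params p m) :=
    (LinearMap.range S.design.mulVecLin).comap (paramsEquiv p m : Params p m →ₗ[ℝ] _) with hK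
  have hmem : ∀ k, run k - θ₀ ∈ K := by
    intro k
    induction k with
    | zero => simp [h0]
    | succ k ih =>
      have hg : gradient (S.batchLoss (B k)) (run k) ∈ K := by
        rw [hK, Submodule.mem_comap]
        exact ⟨_, (S.gradient_batchLoss (B k) (run k)).symm⟩
      rw [hstep k, sub_right_comm]
      exact K.sub_mem ih (K.smul_mem _ hg)
  have : θ - θ₀ ∈ K :=
    (isClosed_of_finiteDimensional K).mem_of_tendsto (hlim.sub_const θ₀)
      (Eventually.of_forall hmem)
  obtain ⟨c, hc⟩ := this
  exact ⟨c, hc.symm⟩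

/-- Pythagoras: the difference of two interpolators lies in the kernel of `Aᵀ`, which is orthogonal
to the range of `A`. Both minimality and uniqueness of the closest interpolator follow from it. -/
theorem norm_sub_sq_eq_of_interpolates {θ₀ θ θ' : Params p m} (h : S.Interpolates θ)
    (h' : S.Interpolates θ') (hr : ∃ c, paramsEquiv p m (θ - θ₀) = S.design *ᵥ c) :
    ‖θ' - θ₀‖ ^ 2 = ‖θ' - θ‖ ^ 2 + ‖θ - θ₀‖ ^ 2 := by
  obtain ⟨c, hc⟩ := hr
  have h0 : inner ℝ (θ' - θ) (θ - θ₀) = 0 := by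
    have h1 : S.designᵀ *ᵥ paramsEquiv p m (θ' - θ) = 0 := by
      rw [map_sub, Matrix.mulVec_sub, ← fitted_eq, ← fitted_eq, h, h', sub_self]
    rw [inner_params, hc, Matrix.dotProduct_mulVec, ← Matrix.mulVec_transpose, h1,
      zero_dotProduct]
  rw [show θ' - θ₀ = (θ' - θ) + (θ - θ₀) by abel, norm_add_sq_real, h0]
  ring

theorem isClosestInterpolator_of_exists_eq_mulVec {θ₀ θ : Params p m} (h : S.Interpolates θ)
    (hr : ∃ c, paramsEquiv p m (θ - θ₀) = S.design *ᵥ c) : S.IsClosestInterpolator θ₀ θ := by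
  refine ⟨h, fun θ' h' => ?_⟩
  have := norm_sub_sq_eq_of_interpolates h h' hr
  exact (pow_le_pow_iff_left₀ (norm_nonneg _) (norm_nonneg _) two_ne_zero).1
    (by linarith [sq_nonneg ‖θ' - θ‖])

/-- The interpolator reached from `θ₀` along the column space of the design matrix. -/
noncomputable def interpolator (S : Sample p m n) (θ₀ : Params p m) : Params p m :=
  θ₀ + (paramsEquiv p m).symm (S.design *ᵥ (S.designᵀ * S.design)⁻¹ *ᵥ
      (S.y - S.designᵀ *ᵥ paramsEquiv p m θ₀))

theorem exists_interpolator_sub_eq (S : Sample p m n) (θ₀ : Params p m) :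
    ∃ c, paramsEquiv p m (S.interpolator θ₀ - θ₀) = S.design *ᵥ c :=
  ⟨_, by rw [interpolator, add_sub_cancel_left, LinearEquiv.apply_symm_apply]⟩

theorem interpolates_interpolator (hG : (S.designᵀ * S.design).det ≠ 0) (θ₀ : Params p m) :
    S.Interpolates (S.interpolator θ₀) := by
  rw [Interpolates, fitted_eq, interpolator, map_add, LinearEquiv.apply_symm_apply,
    Matrix.mulVec_add, Matrix.mulVec_mulVec _ S.designᵀ, mulVec_inv_mulVec hG]
  abel

theorem IsClosestInterpolator.eq_interpolator (hG : (S.designᵀ * S.design).det ≠ 0)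
    {θ₀ θ : Params p m} (h : S.IsClosestInterpolator θ₀ θ) : θ = S.interpolator θ₀ := by
  have hi := interpolates_interpolator hG θ₀
  have h1 := norm_sub_sq_eq_of_interpolates hi h.1 (S.exists_interpolator_sub_eq θ₀)
  have h2 := pow_le_pow_left₀ (norm_nonneg _) (h.2 _ hi) 2
  have h3 : ‖θ - S.interpolator θ₀‖ ^ 2 = 0 := le_antisymm (by linarith) (sq_nonneg _)
  exact sub_eq_zero.1 (norm_eq_zero.1 (pow_eq_zero_iff two_ne_zero |>.1 h3))

theorem IsConvergencePoint.eq_interpolator (hG : (S.designᵀ * S.design).det ≠ 0)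
    {θ₀ θ : Params p m} (h : S.IsConvergencePoint θ₀ θ) : θ = S.interpolator θ₀ :=
  (isClosestInterpolator_of_exists_eq_mulVec h.interpolates h.exists_eq_mulVec).eq_interpolator hG

/-- Gradient descent with a small constant learning rate converges to the interpolator. -/
theorem isConvergencePoint_interpolator (hG : (S.designᵀ * S.design).det ≠ 0)
    (θ₀ : Params p m) : S.IsConvergencePoint θ₀ (S.interpolator θ₀) := by
  set θ' := S.interpolator θ₀ with hθ'
  have hint : S.Interpolates θ' := interpolates_interpolator hG θ₀
  obtain ⟨s, hs, ρ, hρ0, hρ1, hcontr⟩ := exists_contraction_gram S.design hG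
  obtain ⟨C, hC, hC'⟩ := exists_dotProduct_mulVec_self_le S.design
  -- The gradient of the mean squared error carries the factor `2 / n`, so this rate makes one step
  -- act on coefficients as `c ↦ c - s G c`. Without samples the gradient vanishes and any rate will
  -- do.
  obtain ⟨η, hη, hηs⟩ : ∃ η > 0, n ≠ 0 → η * (2 / (n : ℝ)) = s := by
    rcases eq_or_ne n 0 with rfl | hn
    · exact ⟨1, one_pos, fun h => absurd rfl h⟩
    · have : (0 : ℝ) < n := by positivity
      exact ⟨s * n / 2, by positivity, fun _ => by field_simp⟩
  set run : ℕ → Params p m := fun k =>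
    Nat.rec θ₀ (fun _ θ => θ - η • gradient (S.batchLoss Finset.univ) θ) k with hrun
  have hstep : ∀ k, run (k + 1) = run k - η • gradient (S.batchLoss Finset.univ) (run k) :=
    fun _ => rfl
  have hstep' : ∀ θ c, paramsEquiv p m (θ - θ') = S.design *ᵥ c →
      paramsEquiv p m (θ - η • gradient (S.batchLoss Finset.univ) θ - θ') =
        S.design *ᵥ (c - s • (S.designᵀ * S.design) *ᵥ c) := by
    intro θ c hc
    have h1 : S.fitted θ - S.y = (S.designᵀ * S.design) *ᵥ c := by
      rw [← Matrix.mulVec_mulVec, ← hc, map_sub, Matrix.mulVec_sub, ← fitted_eq, ← fitted_eq,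
        show S.fitted θ' = S.y from hint]
    rw [sub_right_comm, map_sub, hc, map_smul, gradient_batchLoss, Matrix.mulVec_sub,
      ← Matrix.mulVec_smul, ← h1]
    congr 2
    ext j
    have hn : n ≠ 0 := j.pos.ne'
    simp [← hηs hn, mul_assoc]
  have hex : ∃ c₀, paramsEquiv p m (θ₀ - θ') = S.design *ᵥ c₀ := by
    obtain ⟨c, hc⟩ := S.exists_interpolator_sub_eq θ₀
    exact ⟨-c, by rw [← neg_sub, map_neg, hc, Matrix.mulVec_neg]⟩
  obtain ⟨c₀, hc₀⟩ := hex
  -- The contraction acts on the coefficients rather than on the parameters: directions orthogonal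
  -- to the range of `A` are never contracted, but the error has no component there.
  have hbound : ∀ k, ∃ c, paramsEquiv p m (run k - θ') = S.design *ᵥ c ∧
      c ⬝ᵥ c ≤ ρ ^ k * (c₀ ⬝ᵥ c₀) := by
    intro k
    induction k with
    | zero => exact ⟨c₀, hc₀, by simp⟩
    | succ k ih =>
      obtain ⟨c, hc, hle⟩ := ih
      refine ⟨_, hstep' _ c hc, (hcontr c).trans ?_⟩
      calc ρ * (c ⬝ᵥ c) ≤ ρ * (ρ ^ k * (c₀ ⬝ᵥ c₀)) := mul_le_mul_of_nonneg_left hle hρ0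
        _ = _ := by ring
  have hnorm : ∀ k, ‖run k - θ'‖ ^ 2 ≤ C * (ρ ^ k * (c₀ ⬝ᵥ c₀)) := by
    intro k
    obtain ⟨c, hc, hle⟩ := hbound k
    rw [norm_sq_params, hc]
    exact (hC' c).trans (mul_le_mul_of_nonneg_left hle hC.le)
  refine ⟨fun _ => η, fun _ => Finset.univ, run, ⟨fun _ => hη, rfl, hstep⟩, ?_,
    S.trainLoss_eq_zero_of_interpolates hint⟩
  rw [tendsto_iff_norm_sub_tendsto_zero]
  have h1 : Tendsto (fun k => C * (ρ ^ k * (c₀ ⬝ᵥ c₀))) atTop (𝓝 0) := by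
    simpa using ((tendsto_pow_atTop_nhds_zero_of_lt_one hρ0 hρ1).mul_const (c₀ ⬝ᵥ c₀)).const_mul C
  have h2 := squeeze_zero (fun k => sq_nonneg _) hnorm h1
  have h3 := h2.sqrt
  simpa [Real.sqrt_sq (norm_nonneg _)] using h3

/-- The ordinary least squares solution. -/
noncomputable def leastSquares (S : Sample p m n) : Params p m :=
  (paramsEquiv p m).symm ((S.design * S.designᵀ)⁻¹ *ᵥ S.design *ᵥ S.y)

/-- The residual `r` at the explicit solution satisfies the normal equation `A r = 0`, hence is
orthogonal to every change `d` of the fitted values. A minimizer must then have `d = 0`, and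
invertibility of `AAᵀ` makes the parameters agree. -/
theorem IsLeastSquares.eq_leastSquares (hG : (S.design * S.designᵀ).det ≠ 0) {θ : Params p m}
    (h : S.IsLeastSquares θ) : θ = S.leastSquares := by
  set θ' := S.leastSquares with hθ'
  set A := S.design with hA
  have hloss : ∀ θ, S.trainLoss θ =
      (1 / (n : ℝ)) * ((S.y - S.fitted θ) ⬝ᵥ (S.y - S.fitted θ)) := by
    intro θ
    simp [trainLoss, batchLoss, dotProduct, sq]
  set r := S.y - S.fitted θ' with hr
  set d := S.fitted θ - S.fitted θ' with hd
  have hAr : A *ᵥ r = 0 := by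
    rw [hr, Matrix.mulVec_sub, fitted_eq, hθ', leastSquares, LinearEquiv.apply_symm_apply,
      Matrix.mulVec_mulVec _ A, mulVec_inv_mulVec hG, sub_self]
  have hdA : d = Aᵀ *ᵥ paramsEquiv p m (θ - θ') := by
    rw [hd, fitted_eq, fitted_eq, ← Matrix.mulVec_sub, map_sub]
  have hrd : r ⬝ᵥ d = 0 := by
    rw [hdA, Matrix.dotProduct_mulVec, Matrix.vecMul_transpose, hAr, zero_dotProduct]
  have hd0 : d = 0 := by
    -- For `n = 0` the loss is constantly `0` and gives no information, but there are no fitted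
    -- values to compare.
    rcases eq_or_ne n 0 with hn | hn
    · subst hn
      exact Subsingleton.elim _ _
    have hle := h θ'
    rw [hloss, hloss] at hle
    have hnpos : (0 : ℝ) < 1 / (n : ℝ) := by positivity
    have hle' := le_of_mul_le_mul_left hle hnpos
    rw [show S.y - S.fitted θ = r - d by rw [hr, hd]; abel, ← hr] at hle'
    simp only [sub_dotProduct, dotProduct_sub, dotProduct_comm d r, hrd] at hle'
    have := dotProduct_self_nonneg_real d
    exact dotProduct_self_eq_zero.1 (le_antisymm (by linarith) this)
  have h1 : (A * Aᵀ) *ᵥ paramsEquiv p m (θ - θ') = 0 := by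
    rw [← Matrix.mulVec_mulVec, ← hdA, hd0, Matrix.mulVec_zero]
  have h2 := inv_mulVec_mulVec hG (paramsEquiv p m (θ - θ'))
  rw [h1, Matrix.mulVec_zero] at h2
  exact sub_eq_zero.1 ((paramsEquiv p m).map_eq_zero_iff.1 h2.symm)

end Sample

/-- The entries of the design matrix and of the noise of one task. -/
abbrev TaskData (κ ν : Type*) : Type _ := (κ × ν → ℝ) × (ν → ℝ)

/-- The law of the data of one task. -/
noncomputable abbrev taskLaw (κ ν : Type*) [Fintype κ] [Fintype ν] (σ : ℝ≥0) :
    Measure (TaskData κ ν) :=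
  (stdPi (κ × ν)).prod (Measure.pi fun _ => gaussianReal 0 (σ ^ 2))

theorem mulVec_dotProduct_mulVec {ι κ ν : Type*} [Fintype ι] [Fintype κ] [Fintype ν]
    (A : Matrix κ ν ℝ) (B : Matrix κ ι ℝ) (x : ν → ℝ) (y : ι → ℝ) :
    (A *ᵥ x) ⬝ᵥ (B *ᵥ y) = x ⬝ᵥ (Aᵀ * B) *ᵥ y := by
  rw [← Matrix.mulVec_mulVec, Matrix.dotProduct_mulVec x, Matrix.vecMul_transpose]

/-! ### The joint law of the data of both tasks. -/

section DataLaw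

/-- The entries of one task, with those of both feature matrices put together. -/
def entriesEquiv (p m n : ℕ) :
    ((Fin p ⊕ Fin m) × Fin n) ⊕ Fin n ≃ (Fin p × Fin n) ⊕ (Fin m × Fin n) ⊕ Fin n :=
  ((Equiv.sumProdDistrib _ _ _).sumCongr (Equiv.refl _)).trans (Equiv.sumAssoc _ _ _)

/-- The variances of the entries of one task. -/
def entryVariance (p m n : ℕ) (σ : ℝ≥0) : (Fin p × Fin n) ⊕ (Fin m × Fin n) ⊕ Fin n → ℝ≥0 :=
  Sum.elim (fun _ => 1) (Sum.elim (fun _ => 1) fun _ => σ ^ 2)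

/-- Gathers the entries of one task into its data. -/
def toTaskData (p m n : ℕ) (a : (Fin p × Fin n) ⊕ (Fin m × Fin n) ⊕ Fin n → ℝ) :
    TaskData (Fin p ⊕ Fin m) (Fin n) :=
  (fun x => a (entriesEquiv p m n (.inl x)), fun j => a (entriesEquiv p m n (.inr j)))

theorem measurePreserving_toTaskData (p m n : ℕ) (σ : ℝ≥0) :
    MeasurePreserving (toTaskData p m n)
      (Measure.pi fun i => gaussianReal 0 (entryVariance p m n σ i))
      (taskLaw (Fin p ⊕ Fin m) (Fin n) σ) := by
  have h1 := measurePreserving_comp_equiv (entriesEquiv p m n)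
    (fun i => gaussianReal 0 (entryVariance p m n σ i))
  have h2 := measurePreserving_sumPiEquivProdPi
    (fun i => gaussianReal 0 (entryVariance p m n σ (entriesEquiv p m n i)))
  have h3 := h2.comp h1
  have h4 : (fun i : (Fin p ⊕ Fin m) × Fin n =>
      gaussianReal 0 (entryVariance p m n σ (entriesEquiv p m n (.inl i)))) =
        fun _ => gaussianReal 0 1 := by
    ext1 ⟨i | i, j⟩ <;> rfl
  rw [h4] at h3
  exact h3

variable {Ω : Type*} [MeasurableSpace Ω] {P : Measure Ω} {p m n : ℕ}
  {X : Ω → Matrix (Fin p) (Fin n) ℝ} {Z : Ω → Matrix (Fin m) (Fin n) ℝ} {ε : Ω → Fin n → ℝ}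
  {σ : ℝ≥0}

theorem HasGaussianEntries.hasLaw (h : HasGaussianEntries P X Z ε σ) (i) :
    HasLaw (entries X Z ε i) (gaussianReal 0 (entryVariance p m n σ i)) P := by
  rcases i with ⟨i, j⟩ | ⟨i, j⟩ | j
  · exact h.common i j
  · exact h.specific i j
  · exact h.noise j

/-- The data of one task. -/
def taskData (X : Ω → Matrix (Fin p) (Fin n) ℝ) (Z : Ω → Matrix (Fin m) (Fin n) ℝ)
    (ε : Ω → Fin n → ℝ) (ω : Ω) : TaskData (Fin p ⊕ Fin m) (Fin n) :=
  toTaskData p m n fun i => entries X Z ε i ω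

/-- Joint independence of all scalar entries makes their law a product measure. Regrouping the
coordinates yields independence between the tasks and between design and noise. -/
theorem hasLaw_taskData_prod [IsProbabilityMeasure P] {m' n' : ℕ}
    {X' : Ω → Matrix (Fin p) (Fin n') ℝ} {Z' : Ω → Matrix (Fin m') (Fin n') ℝ}
    {ε' : Ω → Fin n' → ℝ} {σ' : ℝ≥0}
    (h : HasGaussianEntries P X Z ε σ) (h' : HasGaussianEntries P X' Z' ε' σ')
    (hind : iIndepFun (Sum.elim (entries X Z ε) (entries X' Z' ε')) P) :
    HasLaw (fun ω => (taskData X Z ε ω, taskData X' Z' ε' ω))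
      ((taskLaw (Fin p ⊕ Fin m) (Fin n) σ).prod (taskLaw (Fin p ⊕ Fin m') (Fin n') σ')) P := by
  have hlaw : ∀ i, HasLaw (Sum.elim (entries X Z ε) (entries X' Z' ε') i)
      (gaussianReal 0 (Sum.elim (entryVariance p m n σ) (entryVariance p m' n' σ') i)) P := by
    rintro (i | i)
    · exact h.hasLaw i
    · exact h'.hasLaw i
  have h0 : HasLaw (fun ω i => Sum.elim (entries X Z ε) (entries X' Z' ε') i ω)
      (Measure.pi fun i =>
        gaussianReal 0 (Sum.elim (entryVariance p m n σ) (entryVariance p m' n' σ') i)) P := by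
    refine ⟨aemeasurable_pi_lambda _ fun i => (hlaw i).aemeasurable, ?_⟩
    rw [(iIndepFun_iff_map_fun_eq_pi_map fun i => (hlaw i).aemeasurable).1 hind]
    congr 1 with i
    rw [(hlaw i).map_eq]
  have h1 := ((measurePreserving_toTaskData p m n σ).prod
    (measurePreserving_toTaskData p m' n' σ')).comp (measurePreserving_sumPiEquivProdPi fun i =>
      gaussianReal 0 (Sum.elim (entryVariance p m n σ) (entryVariance p m' n' σ') i))
  exact h1.hasLaw.comp h0

theorem samples_design_eq {Ω : Type*} {p m n : ℕ} (X : Ω → Matrix (Fin p) (Fin n) ℝ) (Z : Ω → Matrix (Fin m) (Fin n) ℝ)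
    (ε : Ω → Fin n → ℝ) (w : EuclideanSpace ℝ (Fin p)) (q : EuclideanSpace ℝ (Fin m)) (ω : Ω) :
    (samples (X ω) (Z ω) (ε ω) w q).design = toMatrix (taskData X Z ε ω).1 := by
  ext (i | i) j <;> rfl

theorem samples_y_eq {Ω : Type*} {p m n : ℕ} (X : Ω → Matrix (Fin p) (Fin n) ℝ) (Z : Ω → Matrix (Fin m) (Fin n) ℝ)
    (ε : Ω → Fin n → ℝ) (w : EuclideanSpace ℝ (Fin p)) (q : EuclideanSpace ℝ (Fin m)) (ω : Ω) :
    (samples (X ω) (Z ω) (ε ω) w q).y =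
      (toMatrix (taskData X Z ε ω).1)ᵀ *ᵥ Sum.elim w.ofLp q.ofLp + (taskData X Z ε ω).2 := by
  rw [← samples_design_eq X Z ε w q]
  ext j
  simp [samples, Sample.design, Matrix.mulVec, dotProduct, taskData, toTaskData, entriesEquiv,
    entries]

end DataLaw

/-! ### Expected errors as integrals over the data of one task. -/

section Expectation

variable {κ ν : Type*} [Fintype κ] [Fintype ν]

/-- By Fubini the noise is integrated first, at a fixed design, and leaves `σ²` times the trace. -/
theorem lintegral_noise_taskLaw [DecidableEq ν] (σ : ℝ≥0) {M : (κ × ν → ℝ) → Matrix ν ν ℝ}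
    (hm : ∀ i j, Measurable fun a => M a i j) (hM : ∀ a, (M a).PosSemidef) :
    ∫⁻ d, ENNReal.ofReal (d.2 ⬝ᵥ M d.1 *ᵥ d.2) ∂(taskLaw κ ν σ) =
      ENNReal.ofReal (σ ^ 2) * ∫⁻ a, ENNReal.ofReal (M a).trace ∂(stdPi (κ × ν)) := by
  have hmeas : Measurable fun d : TaskData κ ν => ENNReal.ofReal (d.2 ⬝ᵥ M d.1 *ᵥ d.2) := by
    simp only [dotProduct, Matrix.mulVec]
    fun_prop
  have htr : Measurable fun a => ENNReal.ofReal (M a).trace := by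
    simp only [Matrix.trace, Matrix.diag_apply]
    fun_prop
  rw [lintegral_prod _ hmeas.aemeasurable, ← lintegral_const_mul _ htr]
  congr 1 with a
  simp only
  rw [lintegral_quadraticForm_pi_gaussianReal _ (hM a), ENNReal.ofReal_mul (by positivity)]
  simp

theorem measurable_inv_toMatrix_transpose_mul [DecidableEq ν] (i j : ν) :
    Measurable fun a : κ × ν → ℝ => ((toMatrix a)ᵀ * toMatrix a)⁻¹ i j := by
  refine measurable_matrix_inv_apply (fun i j => ?_) i j
  simp only [Matrix.mul_apply, Matrix.transpose_apply, Matrix.of_apply]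
  fun_prop

theorem lintegral_interpolator_noise [DecidableEq ν] (σ : ℝ≥0)
    (h : Fintype.card ν + 1 < Fintype.card κ) :
    ∫⁻ d, ENNReal.ofReal (d.2 ⬝ᵥ ((toMatrix d.1)ᵀ * toMatrix d.1)⁻¹ *ᵥ d.2) ∂(taskLaw κ ν σ) =
      ENNReal.ofReal
        (Fintype.card ν * (σ : ℝ) ^ 2 / ((Fintype.card κ : ℝ) - Fintype.card ν - 1)) := by
  rw [lintegral_noise_taskLaw σ (M := fun a => ((toMatrix a)ᵀ * toMatrix a)⁻¹)
    measurable_inv_toMatrix_transpose_mul fun a => posSemidef_inv_transpose_mul _,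
    lintegral_trace_inv_transpose_mul h, ← ENNReal.ofReal_mul (by positivity)]
  congr 1
  ring

variable [DecidableEq κ]

theorem ae_det_mul_transpose_ne_zero (h : Fintype.card κ ≤ Fintype.card ν) :
    ∀ᵐ a ∂(stdPi (κ × ν)), (toMatrix a * (toMatrix a)ᵀ).det ≠ 0 :=
  (measurePreserving_comp_equiv (Equiv.prodComm ν κ)
    (fun _ : κ × ν => gaussianReal 0 1)).quasiMeasurePreserving.ae
      (ae_det_transpose_mul_ne_zero (κ := ν) (ν := κ) h)

theorem lintegral_trace_inv_mul_transpose (h : Fintype.card κ + 1 < Fintype.card ν) :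
    ∫⁻ a, ENNReal.ofReal (toMatrix a * (toMatrix a)ᵀ)⁻¹.trace ∂(stdPi (κ × ν)) =
      ENNReal.ofReal ((Fintype.card κ : ℝ) / ((Fintype.card ν : ℝ) - Fintype.card κ - 1)) := by
  rw [← lintegral_trace_inv_transpose_mul (κ := ν) (ν := κ) h]
  have h1 := measurePreserving_comp_equiv (Equiv.prodComm ν κ) (fun _ : κ × ν => gaussianReal 0 1)
  refine h1.lintegral_comp (f := fun a : ν × κ → ℝ =>
    ENNReal.ofReal ((toMatrix a)ᵀ * toMatrix a)⁻¹.trace) ?_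
  refine Measurable.ennreal_ofReal (Finset.measurable_fun_sum _ fun i _ =>
    measurable_matrix_inv_apply (fun i j => ?_) i i)
  simp only [Matrix.mul_apply, Matrix.transpose_apply, Matrix.of_apply]
  fun_prop

theorem measurable_inv_toMatrix_mul_transpose (i j : κ) :
    Measurable fun a : κ × ν → ℝ => (toMatrix a * (toMatrix a)ᵀ)⁻¹ i j := by
  refine measurable_matrix_inv_apply (fun i j => ?_) i j
  simp only [Matrix.mul_apply, Matrix.transpose_apply, Matrix.of_apply]
  fun_prop

theorem lintegral_leastSquares_error (σ : ℝ≥0) (h : Fintype.card κ + 1 < Fintype.card ν) :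
    ∫⁻ d, ENNReal.ofReal
        (((toMatrix d.1 * (toMatrix d.1)ᵀ)⁻¹ *ᵥ toMatrix d.1 *ᵥ d.2) ⬝ᵥ
          ((toMatrix d.1 * (toMatrix d.1)ᵀ)⁻¹ *ᵥ toMatrix d.1 *ᵥ d.2)) ∂(taskLaw κ ν σ) =
      ENNReal.ofReal
        (Fintype.card κ * (σ : ℝ) ^ 2 / ((Fintype.card ν : ℝ) - Fintype.card κ - 1)) := by
  classical
  set B : (κ × ν → ℝ) → Matrix κ ν ℝ := fun a =>
    (toMatrix a * (toMatrix a)ᵀ)⁻¹ * toMatrix a with hB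
  have hBm : ∀ i j, Measurable fun a => B a i j := by
    intro i j
    simp only [hB, Matrix.mul_apply, Matrix.of_apply]
    exact Finset.measurable_fun_sum _ fun k _ =>
      Measurable.fun_mul (measurable_inv_toMatrix_mul_transpose i k) (measurable_pi_apply _)
  have h1 : ∀ d : TaskData κ ν,
      ((toMatrix d.1 * (toMatrix d.1)ᵀ)⁻¹ *ᵥ toMatrix d.1 *ᵥ d.2) ⬝ᵥ
        ((toMatrix d.1 * (toMatrix d.1)ᵀ)⁻¹ *ᵥ toMatrix d.1 *ᵥ d.2) =
      d.2 ⬝ᵥ ((B d.1)ᵀ * B d.1) *ᵥ d.2 := by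
    intro d
    rw [Matrix.mulVec_mulVec, mulVec_dotProduct_mulVec]
  simp_rw [h1]
  rw [lintegral_noise_taskLaw σ (M := fun a => (B a)ᵀ * B a)]
  -- The trace is cyclic, and `B Bᵀ = (AAᵀ)⁻¹` wherever `AAᵀ` is invertible.
  · have h2 : ∀ᵐ a ∂(stdPi (κ × ν)), ENNReal.ofReal ((B a)ᵀ * B a).trace =
        ENNReal.ofReal (toMatrix a * (toMatrix a)ᵀ)⁻¹.trace := by
      filter_upwards [ae_det_mul_transpose_ne_zero (κ := κ) (ν := ν) (by omega)] with a ha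
      rw [Matrix.trace_mul_comm, hB]
      simp only
      rw [Matrix.transpose_mul, Matrix.mul_assoc, ← Matrix.mul_assoc (toMatrix a),
        Matrix.transpose_nonsing_inv, Matrix.transpose_mul, Matrix.transpose_transpose,
        Matrix.mul_nonsing_inv _ ha.isUnit, Matrix.mul_one]
    rw [lintegral_congr_ae h2, lintegral_trace_inv_mul_transpose h,
      ← ENNReal.ofReal_mul (by positivity)]
    congr 1
    ring
  · intro i j
    simp only [Matrix.mul_apply, Matrix.transpose_apply]
    fun_prop
  · intro a
    have := Matrix.posSemidef_conjTranspose_mul_self (B a)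
    rwa [Matrix.conjTranspose_eq_transpose_of_trivial] at this

/-- The error splits into the part of `x₀ - x` orthogonal to the columns of `A` and a noise term in
their span, so there is no cross term. -/
theorem interpolator_error_eq [DecidableEq ν] {A : Matrix κ ν ℝ} (hG : (Aᵀ * A).det ≠ 0)
    (x₀ x : κ → ℝ) (ε : ν → ℝ) :
    (x₀ + A *ᵥ (Aᵀ * A)⁻¹ *ᵥ (Aᵀ *ᵥ x + ε - Aᵀ *ᵥ x₀) - x) ⬝ᵥ
      (x₀ + A *ᵥ (Aᵀ * A)⁻¹ *ᵥ (Aᵀ *ᵥ x + ε - Aᵀ *ᵥ x₀) - x) =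
    (x₀ - x) ⬝ᵥ residualMatrix A *ᵥ (x₀ - x) + ε ⬝ᵥ (Aᵀ * A)⁻¹ *ᵥ ε := by
  set v := x₀ - x with hv
  have h1 : x₀ + A *ᵥ (Aᵀ * A)⁻¹ *ᵥ (Aᵀ *ᵥ x + ε - Aᵀ *ᵥ x₀) - x =
      residualMatrix A *ᵥ v + A *ᵥ (Aᵀ * A)⁻¹ *ᵥ ε := by
    have : Aᵀ *ᵥ x + ε - Aᵀ *ᵥ x₀ = ε - Aᵀ *ᵥ v := by
      rw [hv, Matrix.mulVec_sub]; abel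
    rw [this, residualMatrix, Matrix.sub_mulVec, Matrix.one_mulVec]
    simp only [Matrix.mulVec_sub, Matrix.mulVec_mulVec, Matrix.mul_assoc, hv]
    abel
  have hQA : residualMatrix A * A = 0 := by
    rw [residualMatrix, Matrix.sub_mul, Matrix.one_mul, Matrix.mul_assoc, Matrix.mul_assoc,
      Matrix.nonsing_inv_mul _ hG.isUnit, Matrix.mul_one, sub_self]
  have hcross : ∀ c, (residualMatrix A *ᵥ v) ⬝ᵥ (A *ᵥ c) = 0 := by
    intro c
    rw [mulVec_dotProduct_mulVec, transpose_residualMatrix, hQA, Matrix.zero_mulVec,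
      dotProduct_zero]
  have hres : (residualMatrix A *ᵥ v) ⬝ᵥ (residualMatrix A *ᵥ v) =
      v ⬝ᵥ residualMatrix A *ᵥ v := by
    rw [mulVec_dotProduct_mulVec, transpose_residualMatrix, residualMatrix_mul_self]
  have hnoise : (A *ᵥ (Aᵀ * A)⁻¹ *ᵥ ε) ⬝ᵥ (A *ᵥ (Aᵀ * A)⁻¹ *ᵥ ε) = ε ⬝ᵥ (Aᵀ * A)⁻¹ *ᵥ ε := by
    rw [Matrix.dotProduct_mulVec, ← Matrix.mulVec_transpose, Matrix.mulVec_mulVec _ Aᵀ,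
      mulVec_inv_mulVec hG]
  rw [h1, add_dotProduct, dotProduct_add, dotProduct_add, hres, hnoise,
    dotProduct_comm (A *ᵥ _) (residualMatrix A *ᵥ v), hcross]
  ring

end Expectation

theorem ae_of_hasLaw {Ω β : Type*} [MeasurableSpace Ω] [MeasurableSpace β] {P : Measure Ω}
    {μ : Measure β} {X : Ω → β} (hX : HasLaw X μ P) {q : β → Prop} (h : ∀ᵐ x ∂μ, q x) :
    ∀ᵐ ω ∂P, q (X ω) :=
  ae_of_ae_map hX.aemeasurable (hX.map_eq.symm ▸ h)

theorem measurable_mulVec {α κ ν : Type*} [MeasurableSpace α] [Fintype ν]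
    {A : α → Matrix κ ν ℝ} (hA : ∀ i j, Measurable fun x => A x i j) {v : α → ν → ℝ}
    (hv : Measurable v) : Measurable fun x => A x *ᵥ v x := by
  refine measurable_pi_lambda _ fun i => ?_
  simp only [Matrix.mulVec, dotProduct]
  fun_prop

theorem measurable_dotProduct {α ν : Type*} [MeasurableSpace α] [Fintype ν] {u v : α → ν → ℝ}
    (hu : Measurable u) (hv : Measurable v) : Measurable fun x => u x ⬝ᵥ v x :=
  Finset.measurable_fun_sum _ fun i _ =>
    Measurable.fun_mul ((measurable_pi_apply i).comp hu) ((measurable_pi_apply i).comp hv)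

/-- Independence at work: `v` is frozen while the design is averaged, which reduces the claim to a
deterministic vector. -/
theorem lintegral_residual_prod_taskLaw {β κ ν : Type*} [MeasurableSpace β] [Fintype κ]
    [DecidableEq κ] [Fintype ν] [DecidableEq ν] (μ : Measure β) [SFinite μ] (σ : ℝ≥0)
    (h : Fintype.card ν ≤ Fintype.card κ) {v : β → κ → ℝ} (hv : Measurable v) :
    ∫⁻ z, ENNReal.ofReal (v z.1 ⬝ᵥ residualMatrix (toMatrix z.2.1) *ᵥ v z.1)
        ∂(μ.prod (taskLaw κ ν σ)) =
      ENNReal.ofReal (1 - (Fintype.card ν : ℝ) / Fintype.card κ) *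
        ∫⁻ b, ENNReal.ofReal (v b ⬝ᵥ v b) ∂μ := by
  have hQ : ∀ k l, Measurable fun z : β × TaskData κ ν => residualMatrix (toMatrix z.2.1) k l :=
    fun k l => (measurable_residualMatrix_toMatrix k l).comp measurable_snd.fst
  have hv' : Measurable fun z : β × TaskData κ ν => v z.1 := hv.comp measurable_fst
  have hmeas : Measurable fun z : β × TaskData κ ν =>
      ENNReal.ofReal (v z.1 ⬝ᵥ residualMatrix (toMatrix z.2.1) *ᵥ v z.1) :=
    (measurable_dotProduct hv' (measurable_mulVec hQ hv')).ennreal_ofReal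
  have hmeas' : Measurable fun b => ENNReal.ofReal (v b ⬝ᵥ v b) :=
    (measurable_dotProduct hv hv).ennreal_ofReal
  rw [lintegral_prod _ hmeas.aemeasurable, ← lintegral_const_mul _ hmeas']
  congr 1 with b
  rw [← lintegral_quadraticForm_residualMatrix h]
  refine measurePreserving_fst.lintegral_comp (f := fun a : κ × ν → ℝ =>
    ENNReal.ofReal (v b ⬝ᵥ residualMatrix (toMatrix a) *ᵥ v b)) ?_
  exact (measurable_dotProduct measurable_const (measurable_mulVec
    measurable_residualMatrix_toMatrix measurable_const)).ennreal_ofReal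

/-! ### The source solution as a measurable function of the source data. -/

section Source

variable {κ ν : Type*} [Fintype κ] [DecidableEq κ] [Fintype ν] [DecidableEq ν]

/-- The parameters learned on the source task, as a function of its data and of the true
parameters `x`. -/
noncomputable def sourceEstimate (x : κ → ℝ) (d : TaskData κ ν) : κ → ℝ :=
  if Fintype.card ν < Fintype.card κ then
    toMatrix d.1 *ᵥ ((toMatrix d.1)ᵀ * toMatrix d.1)⁻¹ *ᵥ ((toMatrix d.1)ᵀ *ᵥ x + d.2)
  else
    (toMatrix d.1 * (toMatrix d.1)ᵀ)⁻¹ *ᵥ toMatrix d.1 *ᵥ ((toMatrix d.1)ᵀ *ᵥ x + d.2)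

theorem measurable_sourceEstimate (x : κ → ℝ) :
    Measurable (sourceEstimate x : TaskData κ ν → κ → ℝ) := by
  have hA : ∀ k j, Measurable fun d : TaskData κ ν => toMatrix d.1 k j := fun k j => by
    simp only [Matrix.of_apply]
    fun_prop
  have hy : Measurable fun d : TaskData κ ν => (toMatrix d.1)ᵀ *ᵥ x + d.2 :=
    (measurable_mulVec (fun j k => hA k j) measurable_const).add measurable_snd
  unfold sourceEstimate
  split_ifs
  · exact measurable_mulVec hA (measurable_mulVec (fun i j =>
      (measurable_inv_toMatrix_transpose_mul i j).comp measurable_fst) hy)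
  · exact measurable_mulVec (fun i j =>
      (measurable_inv_toMatrix_mul_transpose i j).comp measurable_fst) (measurable_mulVec hA hy)

end Source

/-! ### Almost sure identification of the learned parameters, and their expected errors. -/

section Task

variable {Ω : Type*} [MeasurableSpace Ω] {P : Measure Ω} {p m n : ℕ}
  {X : Ω → Matrix (Fin p) (Fin n) ℝ} {Z : Ω → Matrix (Fin m) (Fin n) ℝ} {ε : Ω → Fin n → ℝ}
  {σ : ℝ≥0}

theorem ae_det_design_transpose_mul_ne_zero
    (hlaw : HasLaw (taskData X Z ε) (taskLaw (Fin p ⊕ Fin m) (Fin n) σ) P) (h : n ≤ p + m)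
    (w : EuclideanSpace ℝ (Fin p)) (q : EuclideanSpace ℝ (Fin m)) :
    ∀ᵐ ω ∂P, ((samples (X ω) (Z ω) (ε ω) w q).designᵀ *
      (samples (X ω) (Z ω) (ε ω) w q).design).det ≠ 0 := by
  have h1 := (Measure.quasiMeasurePreserving_fst (μ := stdPi ((Fin p ⊕ Fin m) × Fin n))
    (ν := Measure.pi fun _ : Fin n => gaussianReal 0 (σ ^ 2))).ae
    (ae_det_transpose_mul_ne_zero (κ := Fin p ⊕ Fin m) (ν := Fin n) (by simpa using h))
  filter_upwards [ae_of_hasLaw hlaw h1] with ω hω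
  rwa [samples_design_eq]

theorem ae_det_design_mul_transpose_ne_zero
    (hlaw : HasLaw (taskData X Z ε) (taskLaw (Fin p ⊕ Fin m) (Fin n) σ) P) (h : p + m ≤ n)
    (w : EuclideanSpace ℝ (Fin p)) (q : EuclideanSpace ℝ (Fin m)) :
    ∀ᵐ ω ∂P, ((samples (X ω) (Z ω) (ε ω) w q).design *
      (samples (X ω) (Z ω) (ε ω) w q).designᵀ).det ≠ 0 := by
  have h1 := (Measure.quasiMeasurePreserving_fst (μ := stdPi ((Fin p ⊕ Fin m) × Fin n))
    (ν := Measure.pi fun _ : Fin n => gaussianReal 0 (σ ^ 2))).ae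
    (ae_det_mul_transpose_ne_zero (κ := Fin p ⊕ Fin m) (ν := Fin n) (by simpa using h))
  filter_upwards [ae_of_hasLaw hlaw h1] with ω hω
  rwa [samples_design_eq]

/-- Full rank determines the source solution almost surely. This makes it a measurable function of
the source data alone, hence independent of the target data, although `θ` is not assumed measurable.
-/
theorem ae_sourceSolution_eq_sourceEstimate
    (hlaw : HasLaw (taskData X Z ε) (taskLaw (Fin p ⊕ Fin m) (Fin n) σ) P)
    {w : EuclideanSpace ℝ (Fin p)} {q : EuclideanSpace ℝ (Fin m)} {θ : Ω → Params p m}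
    (hθ : ∀ᵐ ω ∂P, (samples (X ω) (Z ω) (ε ω) w q).IsSourceSolution (θ ω)) :
    ∀ᵐ ω ∂P, paramsEquiv p m (θ ω) =
      sourceEstimate (Sum.elim w.ofLp q.ofLp) (taskData X Z ε ω) := by
  by_cases h : n < p + m
  · filter_upwards [hθ, ae_det_design_transpose_mul_ne_zero hlaw h.le w q] with ω hω hdet
    rw [(hω.1 h).eq_interpolator hdet, Sample.interpolator, sourceEstimate, if_pos (by simpa using h),
      zero_add, LinearEquiv.apply_symm_apply, samples_y_eq, samples_design_eq, map_zero,
      Matrix.mulVec_zero, sub_zero]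
  · rw [not_lt] at h
    filter_upwards [hθ, ae_det_design_mul_transpose_ne_zero hlaw h w q] with ω hω hdet
    rw [(hω.2 h).eq_leastSquares hdet, Sample.leastSquares, sourceEstimate,
      if_neg (by simpa using h), LinearEquiv.apply_symm_apply, samples_y_eq, samples_design_eq]

/-- The expected model error of least squares with more samples than parameters. -/
theorem lintegral_modelError_of_isLeastSquares
    (hlaw : HasLaw (taskData X Z ε) (taskLaw (Fin p ⊕ Fin m) (Fin n) σ) P) (h : p + m + 1 < n)
    {w : EuclideanSpace ℝ (Fin p)} {q : EuclideanSpace ℝ (Fin m)} {θ : Ω → Params p m}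
    (hθ : ∀ᵐ ω ∂P, (samples (X ω) (Z ω) (ε ω) w q).IsLeastSquares (θ ω)) :
    ∫⁻ ω, ENNReal.ofReal (modelError w q (θ ω)) ∂P =
      ENNReal.ofReal (((p : ℝ) + m) * (σ : ℝ) ^ 2 / ((n : ℝ) - p - m - 1)) := by
  have key : ∀ᵐ ω ∂P, ENNReal.ofReal (modelError w q (θ ω)) =
      (fun d : TaskData (Fin p ⊕ Fin m) (Fin n) => ENNReal.ofReal
        (((toMatrix d.1 * (toMatrix d.1)ᵀ)⁻¹ *ᵥ toMatrix d.1 *ᵥ d.2) ⬝ᵥ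
          ((toMatrix d.1 * (toMatrix d.1)ᵀ)⁻¹ *ᵥ toMatrix d.1 *ᵥ d.2))) (taskData X Z ε ω) := by
    filter_upwards [hθ, ae_det_design_mul_transpose_ne_zero hlaw (by omega) w q] with ω hω hdet
    rw [modelError_eq, hω.eq_leastSquares hdet, Sample.leastSquares,
      LinearEquiv.apply_symm_apply, samples_y_eq, samples_design_eq]
    rw [samples_design_eq] at hdet
    -- The noiseless part of the outputs reproduces the true parameters exactly, so only the noise
    -- term survives.
    rw [Matrix.mulVec_add, Matrix.mulVec_add, Matrix.mulVec_mulVec _ (toMatrix _),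
      inv_mulVec_mulVec hdet, add_sub_cancel_left]
  have hm : Measurable fun d : TaskData (Fin p ⊕ Fin m) (Fin n) => ENNReal.ofReal
      (((toMatrix d.1 * (toMatrix d.1)ᵀ)⁻¹ *ᵥ toMatrix d.1 *ᵥ d.2) ⬝ᵥ
        ((toMatrix d.1 * (toMatrix d.1)ᵀ)⁻¹ *ᵥ toMatrix d.1 *ᵥ d.2)) := by
    have hA : ∀ k j, Measurable fun d : TaskData (Fin p ⊕ Fin m) (Fin n) => toMatrix d.1 k j :=
      fun k j => by
        simp only [Matrix.of_apply]
        fun_prop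
    have hB := measurable_mulVec (fun i j => (measurable_inv_toMatrix_mul_transpose i j).comp
      measurable_fst) (measurable_mulVec hA measurable_snd)
    exact (measurable_dotProduct hB hB).ennreal_ofReal
  rw [lintegral_congr_ae key, hlaw.lintegral_comp hm.aemeasurable,
    lintegral_leastSquares_error σ (by simpa using h)]
  congr 1
  simp only [Fintype.card_sum, Fintype.card_fin, Nat.cast_add]
  ring

/-- The expected model error of the interpolator from an initial point `x₀` that depends on
independent data. -/
theorem lintegral_modelError_of_eq_interpolator {β : Type*} [MeasurableSpace β] {μ : Measure β}
    [IsProbabilityMeasure μ] {D : Ω → β}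
    (hlaw : HasLaw (fun ω => (D ω, taskData X Z ε ω))
      (μ.prod (taskLaw (Fin p ⊕ Fin m) (Fin n) σ)) P) (h : n + 1 < p + m)
    {w : EuclideanSpace ℝ (Fin p)} {q : EuclideanSpace ℝ (Fin m)} {θ₀ θ : Ω → Params p m}
    {x₀ : β → Fin p ⊕ Fin m → ℝ} (hx₀ : Measurable x₀)
    (hθ₀ : ∀ᵐ ω ∂P, paramsEquiv p m (θ₀ ω) = x₀ (D ω))
    (hθ : ∀ᵐ ω ∂P, θ ω = (samples (X ω) (Z ω) (ε ω) w q).interpolator (θ₀ ω)) :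
    ∫⁻ ω, ENNReal.ofReal (modelError w q (θ ω)) ∂P =
      ENNReal.ofReal (1 - (n : ℝ) / ((p : ℝ) + m)) *
          ∫⁻ ω, ENNReal.ofReal (modelError w q (θ₀ ω)) ∂P +
        ENNReal.ofReal ((n : ℝ) * (σ : ℝ) ^ 2 / ((p : ℝ) + m - n - 1)) := by
  set x := Sum.elim w.ofLp q.ofLp with hx
  have hlaw₂ : HasLaw (taskData X Z ε) (taskLaw (Fin p ⊕ Fin m) (Fin n) σ) P :=
    measurePreserving_snd.comp_hasLaw hlaw
  have hlaw₁ : HasLaw D μ P := measurePreserving_fst.comp_hasLaw hlaw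
  have hv : Measurable fun b => x₀ b - x := hx₀.sub_const x
  have key : ∀ᵐ ω ∂P, ENNReal.ofReal (modelError w q (θ ω)) =
      (fun z : β × TaskData (Fin p ⊕ Fin m) (Fin n) =>
        ENNReal.ofReal ((x₀ z.1 - x) ⬝ᵥ residualMatrix (toMatrix z.2.1) *ᵥ (x₀ z.1 - x)) +
          ENNReal.ofReal (z.2.2 ⬝ᵥ ((toMatrix z.2.1)ᵀ * toMatrix z.2.1)⁻¹ *ᵥ z.2.2))
        (D ω, taskData X Z ε ω) := by
    filter_upwards [hθ, hθ₀, ae_det_design_transpose_mul_ne_zero hlaw₂ (by omega) w q]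
      with ω hω hω₀ hdet
    rw [samples_design_eq] at hdet
    rw [modelError_eq, hω, Sample.interpolator, map_add, LinearEquiv.apply_symm_apply, hω₀,
      samples_y_eq, samples_design_eq, interpolator_error_eq hdet, ENNReal.ofReal_add]
    · simpa using (posSemidef_residualMatrix (toMatrix (taskData X Z ε ω).1)).dotProduct_mulVec_nonneg
        (x₀ (D ω) - x)
    · simpa using (posSemidef_inv_transpose_mul
        (toMatrix (taskData X Z ε ω).1)).dotProduct_mulVec_nonneg (taskData X Z ε ω).2
  have key₀ : ∀ᵐ ω ∂P, ENNReal.ofReal (modelError w q (θ₀ ω)) =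
      (fun b => ENNReal.ofReal ((x₀ b - x) ⬝ᵥ (x₀ b - x))) (D ω) := by
    filter_upwards [hθ₀] with ω hω₀
    rw [modelError_eq, hω₀]
  have hQ : ∀ k l, Measurable fun z : β × TaskData (Fin p ⊕ Fin m) (Fin n) =>
      residualMatrix (toMatrix z.2.1) k l :=
    fun k l => (measurable_residualMatrix_toMatrix k l).comp measurable_snd.fst
  have hG : ∀ i j, Measurable fun d : TaskData (Fin p ⊕ Fin m) (Fin n) =>
      ((toMatrix d.1)ᵀ * toMatrix d.1)⁻¹ i j :=
    fun i j => (measurable_inv_toMatrix_transpose_mul i j).comp measurable_fst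
  have hm₀ : Measurable fun b => ENNReal.ofReal ((x₀ b - x) ⬝ᵥ (x₀ b - x)) :=
    (measurable_dotProduct hv hv).ennreal_ofReal
  have hv' : Measurable fun z : β × TaskData (Fin p ⊕ Fin m) (Fin n) => x₀ z.1 - x :=
    hv.comp measurable_fst
  have hm₁ : Measurable fun z : β × TaskData (Fin p ⊕ Fin m) (Fin n) =>
      ENNReal.ofReal ((x₀ z.1 - x) ⬝ᵥ residualMatrix (toMatrix z.2.1) *ᵥ (x₀ z.1 - x)) :=
    (measurable_dotProduct hv' (measurable_mulVec hQ hv')).ennreal_ofReal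
  have hm₂ : Measurable fun d : TaskData (Fin p ⊕ Fin m) (Fin n) =>
      ENNReal.ofReal (d.2 ⬝ᵥ ((toMatrix d.1)ᵀ * toMatrix d.1)⁻¹ *ᵥ d.2) :=
    (measurable_dotProduct measurable_snd (measurable_mulVec hG measurable_snd)).ennreal_ofReal
  have hnoise : ∫⁻ z : β × TaskData (Fin p ⊕ Fin m) (Fin n),
      ENNReal.ofReal (z.2.2 ⬝ᵥ ((toMatrix z.2.1)ᵀ * toMatrix z.2.1)⁻¹ *ᵥ z.2.2)
        ∂(μ.prod (taskLaw (Fin p ⊕ Fin m) (Fin n) σ)) =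
      ENNReal.ofReal ((n : ℝ) * (σ : ℝ) ^ 2 / ((p : ℝ) + m - n - 1)) := by
    refine (measurePreserving_snd.lintegral_comp hm₂).trans ?_
    rw [lintegral_interpolator_noise σ (by simpa using h)]
    simp only [Fintype.card_sum, Fintype.card_fin, Nat.cast_add]
  have hres := lintegral_residual_prod_taskLaw (κ := Fin p ⊕ Fin m) (ν := Fin n) μ σ
    (by simp only [Fintype.card_sum, Fintype.card_fin]; omega) hv
  have hm : Measurable fun z : β × TaskData (Fin p ⊕ Fin m) (Fin n) =>
      ENNReal.ofReal ((x₀ z.1 - x) ⬝ᵥ residualMatrix (toMatrix z.2.1) *ᵥ (x₀ z.1 - x)) +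
        ENNReal.ofReal (z.2.2 ⬝ᵥ ((toMatrix z.2.1)ᵀ * toMatrix z.2.1)⁻¹ *ᵥ z.2.2) :=
    Measurable.fun_add hm₁ (hm₂.comp measurable_snd)
  rw [lintegral_congr_ae key, lintegral_congr_ae key₀, hlaw.lintegral_comp hm.aemeasurable,
    hlaw₁.lintegral_comp hm₀.aemeasurable, lintegral_add_left hm₁, hres, hnoise]
  simp only [Fintype.card_sum, Fintype.card_fin, Nat.cast_add]

end Task

theorem modelError_init {p m : ℕ} (w w' : EuclideanSpace ℝ (Fin p)) (q : EuclideanSpace ℝ (Fin m)) :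
    modelError w q (WithLp.toLp 2 (w', 0)) = ‖w - w'‖ ^ 2 + ‖q‖ ^ 2 := by
  simp [modelError, norm_sub_rev]

end PartialTransfer

/-! ### Assembly of both regimes. -/

theorem theorem3 {Ω : Type*} [MeasurableSpace Ω] (P : Measure Ω) [IsProbabilityMeasure P]
    -- numbers of common features, of task-specific features, and of samples; noise levels
    (p p₁ p₂ n₁ n₂ : ℕ) (σ₁ σ₂ : ℝ≥0)
    -- true parameters of the source task and of the target task
    (w₁ w₂ : EuclideanSpace ℝ (Fin p))
    (q₁ : EuclideanSpace ℝ (Fin p₁)) (q₂ : EuclideanSpace ℝ (Fin p₂))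
    -- training inputs and noise of both tasks
    (X₁ : Ω → Matrix (Fin p) (Fin n₁) ℝ) (Z₁ : Ω → Matrix (Fin p₁) (Fin n₁) ℝ)
    (ε₁ : Ω → Fin n₁ → ℝ)
    (X₂ : Ω → Matrix (Fin p) (Fin n₂) ℝ) (Z₂ : Ω → Matrix (Fin p₂) (Fin n₂) ℝ)
    (ε₂ : Ω → Fin n₂ → ℝ)
    (hlaw₁ : PartialTransfer.HasGaussianEntries P X₁ Z₁ ε₁ σ₁)
    (hlaw₂ : PartialTransfer.HasGaussianEntries P X₂ Z₂ ε₂ σ₂)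
    (hindep : iIndepFun
      (Sum.elim (PartialTransfer.entries X₁ Z₁ ε₁) (PartialTransfer.entries X₂ Z₂ ε₂)) P)
    -- learned parameters of the source task and, by Option B, of the target task
    (θ₁ : Ω → PartialTransfer.Params p p₁) (θ₂ : Ω → PartialTransfer.Params p p₂)
    (hθ₁ : ∀ᵐ ω ∂P,
      (PartialTransfer.samples (X₁ ω) (Z₁ ω) (ε₁ ω) w₁ q₁).IsSourceSolution (θ₁ ω))
    (hθ₂ : ∀ᵐ ω ∂P,
      (PartialTransfer.samples (X₂ ω) (Z₂ ω) (ε₂ ω) w₂ q₂).IsOptionB (θ₁ ω).fst (θ₂ ω)) :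
    (n₂ + 1 < p + p₂ →
      (∀ᵐ ω ∂P, ∃! θ : PartialTransfer.Params p p₂,
        (PartialTransfer.samples (X₂ ω) (Z₂ ω) (ε₂ ω) w₂ q₂).IsConvergencePoint
          (WithLp.toLp 2 ((θ₁ ω).fst, 0)) θ) ∧
      (∀ᵐ ω ∂P,
        (PartialTransfer.samples (X₂ ω) (Z₂ ω) (ε₂ ω) w₂ q₂).IsClosestInterpolator
          (WithLp.toLp 2 ((θ₁ ω).fst, 0)) (θ₂ ω)) ∧
      ∫⁻ ω, ENNReal.ofReal (PartialTransfer.modelError w₂ q₂ (θ₂ ω)) ∂P =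
        ENNReal.ofReal (1 - (n₂ : ℝ) / ((p : ℝ) + p₂)) *
            (PartialTransfer.transferError P w₂ (fun ω => (θ₁ ω).fst) +
              ENNReal.ofReal (‖q₂‖ ^ 2)) +
          ENNReal.ofReal ((n₂ : ℝ) * (σ₂ : ℝ) ^ 2 / ((p : ℝ) + p₂ - n₂ - 1))) ∧
    (p + p₂ + 1 < n₂ →
      ∫⁻ ω, ENNReal.ofReal (PartialTransfer.modelError w₂ q₂ (θ₂ ω)) ∂P =
        ENNReal.ofReal (((p : ℝ) + p₂) * (σ₂ : ℝ) ^ 2 / ((n₂ : ℝ) - p - p₂ - 1))) := by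
  open PartialTransfer in
  have hlaw := hasLaw_taskData_prod hlaw₁ hlaw₂ hindep
  have hD₁ : HasLaw (taskData X₁ Z₁ ε₁) (taskLaw (Fin p ⊕ Fin p₁) (Fin n₁) σ₁) P :=
    measurePreserving_fst.comp_hasLaw hlaw
  have hD₂ : HasLaw (taskData X₂ Z₂ ε₂) (taskLaw (Fin p ⊕ Fin p₂) (Fin n₂) σ₂) P :=
    measurePreserving_snd.comp_hasLaw hlaw
  refine ⟨fun h => ?_, fun h => ?_⟩
  · have hn : n₂ < p + p₂ := by omega
    have hdet := ae_det_design_transpose_mul_ne_zero hD₂ hn.le w₂ q₂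
    refine ⟨?_, ?_, ?_⟩
    · filter_upwards [hdet] with ω hω
      exact ⟨_, Sample.isConvergencePoint_interpolator hω _, fun θ hθ => hθ.eq_interpolator hω⟩
    · filter_upwards [hθ₂] with ω hω
      exact Sample.isClosestInterpolator_of_exists_eq_mulVec (hω.1 hn).interpolates
        (hω.1 hn).exists_eq_mulVec
    -- The initial point as a function of the source data: the common block of the source estimate,
    -- and `0` in the target-specific block.
    · set x₀ : TaskData (Fin p ⊕ Fin p₁) (Fin n₁) → Fin p ⊕ Fin p₂ → ℝ := fun d =>
        Sum.elim (sourceEstimate (Sum.elim w₁.ofLp q₁.ofLp) d ∘ Sum.inl) 0 with hx₀def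
      have hx₀ : Measurable x₀ := by
        refine measurable_pi_lambda _ fun k => ?_
        rcases k with k | k
        · exact (measurable_pi_apply (Sum.inl k)).comp
            (measurable_sourceEstimate (Sum.elim w₁.ofLp q₁.ofLp))
        · exact measurable_const
      have hθ₀ : ∀ᵐ ω ∂P, paramsEquiv p p₂ (WithLp.toLp 2 ((θ₁ ω).fst, 0)) =
          x₀ (taskData X₁ Z₁ ε₁ ω) := by
        filter_upwards [ae_sourceSolution_eq_sourceEstimate hD₁ hθ₁] with ω hω
        rw [hx₀def]
        simp only [← hω]
        rfl
      have hθ : ∀ᵐ ω ∂P, θ₂ ω = (samples (X₂ ω) (Z₂ ω) (ε₂ ω) w₂ q₂).interpolator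
          (WithLp.toLp 2 ((θ₁ ω).fst, 0)) := by
        filter_upwards [hθ₂, hdet] with ω hω hω'
        exact (hω.1 hn).eq_interpolator hω'
      rw [lintegral_modelError_of_eq_interpolator hlaw h hx₀ hθ₀ hθ]
      simp_rw [modelError_init, ENNReal.ofReal_add (sq_nonneg _) (sq_nonneg _)]
      -- Only the constant summand `‖q₂‖²` has to be measurable here, so the integral splits without
      -- measurability of `θ₁`.
      rw [lintegral_add_right _ measurable_const, lintegral_const, measure_univ, mul_one,
        transferError]
  · refine lintegral_modelError_of_isLeastSquares hD₂ h ?_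
    filter_upwards [hθ₂] with ω hω
    exact hω.2 (by omega)
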